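/- **Setting.** Let $\mathcal C$ and $\mathcal Y\neq\emptyset$ be finite sets (information items and Receiver responses), $m=|\mathcal Y|$, let $\mu$ be a prior on $\mathcal C$ with $\mu_c>0$ for all $c$, and let $u,v:\mathcal C\times\mathcal Y\to\mathbb R$ be the utilities of the Receiver and of the Advisor, with $|v(c,y)|\le B$ for all $c,y$. A direct signaling scheme is a map $\phi:\mathcal C\to\Delta(\mathcal Y)$. It is persuasive if every response $y$ that is recommended with positive probability maximizes the Receiver's expected utility under the posterior $\Pr(c\mid y)=\mu_c\phi_c(y)/\sum_{c'}\mu_{c'}\phi_{c'}(y)$. Let $\mathcal P$ be the set of direct, persuasive schemes, and put $$v(\phi)=\sum_{c\in\mathcal C}\sum_{y\in\mathcal Y}\mu_c\phi_c(y)v(c,y),\qquad f(\phi)=\Big[-\sum_{c\in\mathcal C}\mu_c\phi_c(y)v(c,y)\Big]_{y\in\mathcal Y}\in\mathbb R^{\mathcal Y}.$$ **Regret minimizers.** A recommender $\mathcal R$ for a set $X\subseteq\mathbb R^{\mathcal Y}$ chooses in every round, possibly at random, a point $z_t\in X$ depending on its earlier recommendations and on the scalar feedback received after each of them. It is a regret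 minimizer with bound $\rho$ if the following holds for every sequence of linear functions $g_1,g_2,\dots$ (not revealed to it) and every feedback rule which, after $z_t$ is played, returns one random number (of discrete law depending only on $t$ and $z_t$) in $[-B,B]$ with mean $g_t(z_t)$: for all $T\ge2$ and $x\in X$, $\ \sum_{t\le T}g_t(x)-\mathbb E\sum_{t\le T}g_t(z_t)\le\rho(T)$. **Algorithm.** Given a recommender $\mathcal R$ for the convex hull $\mathrm{co}\,f(\mathcal P)$, in each round $t=1,\dots,T$: $\mathcal R$ recommends $z_t\in\mathrm{co}\,f(\mathcal P)$; a decomposition subroutine writes $z_t=\sum_{i=1}^{m+1}\lambda_t^{(i)}f(\phi_t^{(i)})$ with $\phi_t^{(i)}\in\mathcal P$ and convex weights $\lambda_t^{(i)}$; an index $i_t$ is drawn with these weights and $\phi_t=\phi_t^{(i_t)}$; an item $c_t\sim\mu$ is observed and a response $y_t\sim\phi_t(\cdot\mid c_t)$ is played; $\mathcal R$ observes the number $v(c_t,y_t)$. The Advisor's regret is $R_T=\max_{\phi\in\mathcal P}\sum_{t=1}^Tv(\phi)-\sum_{t=1}^Tv(\phi_t)$. **Theorem.** There is an absolute constant $K>0$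 such that in every such setting the maximum of $v$ over $\mathcal P$ is attained, a decomposition subroutine exists (Carathéodory), and there is a regret minimizer $\mathcal R$ for $\mathrm{co}\,f(\mathcal P)$ with bound $\rho(T)=K\,B\,m^{3/2}\sqrt{T\log T}$ for which, with every decomposition subroutine and for every $T\ge2$, the algorithm guarantees $$\mathbb E[R_T]\le K\,B\,m^{3/2}\sqrt{T\log T}.$$ In particular $\mathbb E[R_T]=O(m^{3/2}\sqrt{T\log T})$ for utilities $v$ bounded by a constant. -/

import Mathlib

noncomputable section

/-- Expectation of a real function under a discrete probability distribution. -/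
def pmfExpect {α : Type*} (p : PMF α) (F : α → ℝ) : ℝ :=
  ∑' a, (p a).toReal * F a

/-! ### Regret minimizers with scalar (bandit) feedback -/

/-- A (randomized) online decision maker on the set `X`.  `recommend h` is the law of the next
recommended point, given the history `h` of the decision maker's earlier recommendations and of
the scalar feedback observed after each of them (most recent round first). -/
structure Recommender {E : Type*} (X : Set E) where
  recommend : List (X × ℝ) → PMF X

/-- An (oblivious) environment: in round `t` there is a linear payoff function `payoff t`, not
revealed to the decision maker.  After the decision maker plays `z`, it observes only one number,
drawn from `feedback t z`, which lies in `[-B, B]` and has mean `payoff t z`.  Noiseless bandit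
feedback is the case in which `feedback t z` is a point mass at `payoff t z`. -/
structure BanditEnvironment {E : Type*} [AddCommGroup E] [Module ℝ E] (X : Set E) (B : ℝ) where
  payoff : ℕ → E →ₗ[ℝ] ℝ
  feedback : ℕ → X → PMF ℝ
  bounded : ∀ t z, ∀ r ∈ (feedback t z).support, |r| ≤ B
  unbiased : ∀ t (z : X), pmfExpect (feedback t z) id = payoff t z

namespace BanditEnvironment

variable {E : Type*} [AddCommGroup E] [Module ℝ E] {X : Set E} {B : ℝ}

/-- Law of the history after `n` rounds (most recent round first). -/
def play (env : BanditEnvironment X B) (R : Recommender X) : ℕ → PMF (List (X × ℝ))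
  | 0 => PMF.pure []
  | n + 1 => (env.play R n).bind fun h =>
      (R.recommend h).bind fun z =>
        (env.feedback n z).bind fun r => PMF.pure ((z, r) :: h)

/-- The cumulative payoff `∑ₜ payoff t (zₜ)` of the points played along a history. -/
def cumPayoff (env : BanditEnvironment X B) : List (X × ℝ) → ℝ
  | [] => 0
  | (z, _) :: h => env.payoff h.length (z : E) + env.cumPayoff h

end BanditEnvironment

/-- `R` is a regret minimizer for `X` with regret bound `ρ`: against every environment with
unknown linear payoffs and feedback in `[-B, B]`, and for every horizon `T ≥ 2`, its expected
regret against every fixed point of `X` is at most `ρ T`. -/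
def Recommender.IsRegretMinimizer {E : Type*} [AddCommGroup E] [Module ℝ E] {X : Set E}
    (R : Recommender X) (B : ℝ) (ρ : ℕ → ℝ) : Prop :=
  ∀ env : BanditEnvironment X B, ∀ T : ℕ, 2 ≤ T → ∀ x ∈ X,
    ∑ t ∈ Finset.range T, env.payoff t x - pmfExpect (env.play R T) env.cumPayoff ≤ ρ T

/-! ### Bayesian persuasion -/

/-- A persuasion problem with information items `C` and responses `Y`: a common prior in the
interior of the simplex, the Receiver's utility `u` and the Advisor's utility `v`. -/
structure PersuasionProblem (C Y : Type*) where
  prior : PMF C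
  prior_pos : ∀ c, 0 < prior c
  u : C → Y → ℝ
  v : C → Y → ℝ

/-- A direct signaling scheme: every information item is mapped to a distribution over
recommended responses. -/
abbrev DirectScheme (C Y : Type*) := C → PMF Y

namespace PersuasionProblem

variable {C Y : Type*} [Fintype C] [Fintype Y] (I : PersuasionProblem C Y)

/-- The probability that the scheme `φ` sends the recommendation `y`. -/
def signalProb (φ : DirectScheme C Y) (y : Y) : ℝ :=
  ∑ c, (I.prior c).toReal * (φ c y).toReal

/-- The posterior probability of the item `c` given the recommendation `y` (Bayes' rule). -/
def posterior (φ : DirectScheme C Y) (y : Y) (c : C) : ℝ :=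
  (I.prior c).toReal * (φ c y).toReal / I.signalProb φ y

/-- The Receiver's optimal responses under the belief `b` over information items. -/
def bestResponses (b : C → ℝ) : Set Y :=
  {y | ∀ y', ∑ c, b c * I.u c y' ≤ ∑ c, b c * I.u c y}

/-- The set `𝒫` of direct and persuasive schemes: following any recommendation that is sent with
positive probability is optimal for the Receiver under its posterior belief. -/
def persuasiveSchemes : Set (DirectScheme C Y) :=
  {φ | ∀ y, 0 < I.signalProb φ y → y ∈ I.bestResponses (I.posterior φ y)}

/-- The Advisor's expected utility `v(φ)`. -/
def advisorUtility (φ : DirectScheme C Y) : ℝ :=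
  ∑ c, ∑ y, (I.prior c).toReal * (φ c y).toReal * I.v c y

/-- The linear map `(φ_c(y))_{c,y} ↦ [-∑ c, μ_c φ_c(y) v(c,y)]_y`. -/
def embedLinear : (C → Y → ℝ) →ₗ[ℝ] (Y → ℝ) where
  toFun w := fun y => -∑ c, (I.prior c).toReal * w c y * I.v c y
  map_add' w w' := by
    funext y
    simp only [Pi.add_apply, mul_add, add_mul, Finset.sum_add_distrib]
    ring
  map_smul' a w := by
    funext y
    simp only [Pi.smul_apply, smul_eq_mul, RingHom.id_apply, mul_neg, Finset.mul_sum]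
    congr 1
    exact Finset.sum_congr rfl fun c _ => by ring

/-- `f(φ) = [-v(φ, y)]_y`. -/
def embed (φ : DirectScheme C Y) : Y → ℝ :=
  I.embedLinear fun c y => (φ c y).toReal

/-- The set `co f(𝒫)`. -/
def hull : Set (Y → ℝ) :=
  convexHull ℝ (I.embed '' I.persuasiveSchemes)

/-- A subroutine DECOMPOSE: it writes every `z ∈ co f(𝒫)` as a convex combination of the images
of `m + 1` direct and persuasive schemes, `m` being the number of responses. -/
structure Decomposition where
  scheme : I.hull → Fin (Fintype.card Y + 1) → I.persuasiveSchemes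
  weight : I.hull → PMF (Fin (Fintype.card Y + 1))
  combine : ∀ z : I.hull,
    ∑ i, (weight z i).toReal • I.embed (scheme z i : DirectScheme C Y) = (z : Y → ℝ)

/-- What happens in one round: the recommended point, the sampled scheme, the realized
information item and the realized response. -/
structure Round where
  point : I.hull
  scheme : I.persuasiveSchemes
  item : C
  response : Y

/-- What the regret minimizer has seen of a history: its own recommendations and the realized
utilities `v(cₜ, yₜ)`. -/
def observed (h : List I.Round) : List (I.hull × ℝ) :=
  h.map fun r => (r.point, I.v r.item r.response)

/-- The persuasion algorithm with the regret minimizer `R` and the subroutine `D`: the law of the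
history after `n` rounds (most recent round first).  In each round `zₜ` is recommended by `R`,
an index is drawn with the weights of the decomposition of `zₜ`, the scheme with this index is
used, the item is drawn from the prior, and the response from the scheme given the item. -/
def run (R : Recommender I.hull) (D : I.Decomposition) : ℕ → PMF (List I.Round)
  | 0 => PMF.pure []
  | n + 1 => (run R D n).bind fun h =>
      (R.recommend (I.observed h)).bind fun z =>
        (D.weight z).bind fun i =>
          I.prior.bind fun c =>
            ((D.scheme z i : DirectScheme C Y) c).bind fun y =>
              PMF.pure (⟨z, D.scheme z i, c, y⟩ :: h)

/-- The regret `R_T = max_{φ ∈ 𝒫} ∑ₜ v(φ) - ∑ₜ v(φₜ)` along a history of `T` rounds. -/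
def regret (T : ℕ) (h : List I.Round) : ℝ :=
  sSup ((fun φ => ∑ _t ∈ Finset.range T, I.advisorUtility φ) '' I.persuasiveSchemes) -
    (h.map fun r => I.advisorUtility (r.scheme : DirectScheme C Y)).sum

/-- The expected regret of the algorithm after `T` rounds. -/
def expectedRegret (R : Recommender I.hull) (D : I.Decomposition) (T : ℕ) : ℝ :=
  pmfExpect (I.run R D T) (I.regret T)

end PersuasionProblem

end

/-! After clearing denominators, persuasiveness is a system of linear inequalities in the
conditional response distributions. The persuasive schemes thus form a compact convex polytope
(`image_persuasiveSchemes`), and `f` maps it linearly onto a compact convex set, which is its own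
hull (`hull_eq`). The Advisor's utility is minus the coordinate sum of `f(φ)`, and the realized
utility estimates it without bias and within `[-B, B]`. So the algorithm runs a linear bandit in
dimension at most `m` (`map_observed_run`), and its expected regret is the bandit regret
(`expectedRegret_le`).

The recommender is exponential weights with least squares payoff estimates, in the coordinates of a
barycentric spanner (`exists_barycentric_spanner`), mixed with uniform exploration of the spanner.
Exploration keeps the second moment matrix `Q` invertible and the estimates small enough for a
second-order expansion of the log-partition potential. At rate `η` one round costs `O(η m² B²)`
(`pmfExpect_potential_update_le`): exploration contributes the `m²`, the variance `E[zᵀQ⁻¹z]` only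
the dimension. The prior gives mass to nets of all scales (`exists_net_prior`), so every comparator
is within `1/T` of an atom of mass at least `T^(-O(m))`, at a price `O(m log T)/η`. Lowering `η`
never raises the potential (`log_pmfExpect_exp_div_mono`), so decreasing rates cost nothing extra.

Rates of order `√(log t / t) / (B√m)` balance `m log T / η` against `m² B² ∑ η` and give `B m^(3/2)
√(T log T)`. The cap on the rate that exploration requires costs `O(B m³ log T)`, which is absorbed
once `m³ log T ≤ T`; for shorter horizons the trivial bound `2BT` suffices. -/

noncomputable section

/-! ### Expectations, mixtures and exponential tilts of discrete distributions. -/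

namespace PMF

variable {α β : Type*}

/-- A real function that is bounded on the support of a discrete distribution. -/
def BoundedOn (p : PMF α) (F : α → ℝ) : Prop := ∃ M, ∀ a ∈ p.support, |F a| ≤ M

theorem BoundedOn.of_le {p : PMF α} {F : α → ℝ} (M : ℝ) (h : ∀ a, |F a| ≤ M) : p.BoundedOn F :=
  ⟨M, fun a _ => h a⟩

theorem BoundedOn.const {p : PMF α} (c : ℝ) : p.BoundedOn fun _ => c := ⟨|c|, fun _ _ => le_rfl⟩

theorem BoundedOn.add {p : PMF α} {F G : α → ℝ} (hF : p.BoundedOn F) (hG : p.BoundedOn G) :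
    p.BoundedOn fun a => F a + G a := by
  obtain ⟨M, hM⟩ := hF
  obtain ⟨N, hN⟩ := hG
  exact ⟨M + N, fun a ha => (abs_add_le _ _).trans (add_le_add (hM a ha) (hN a ha))⟩

theorem BoundedOn.mul {p : PMF α} {F G : α → ℝ} (hF : p.BoundedOn F) (hG : p.BoundedOn G) :
    p.BoundedOn fun a => F a * G a := by
  obtain ⟨M, hM⟩ := hF
  obtain ⟨N, hN⟩ := hG
  refine ⟨M * N, fun a ha => ?_⟩
  rw [abs_mul]
  exact mul_le_mul (hM a ha) (hN a ha) (abs_nonneg _) ((abs_nonneg _).trans (hM a ha))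

theorem BoundedOn.const_mul {p : PMF α} {F : α → ℝ} (c : ℝ) (hF : p.BoundedOn F) :
    p.BoundedOn fun a => c * F a := (BoundedOn.const c).mul hF

theorem BoundedOn.pow {p : PMF α} {F : α → ℝ} (hF : p.BoundedOn F) (n : ℕ) :
    p.BoundedOn fun a => F a ^ n := by
  induction n with
  | zero => simpa using BoundedOn.const (p := p) 1
  | succ n ih => simpa [pow_succ] using ih.mul hF

theorem BoundedOn.sum {p : PMF α} {ι : Type*} {s : Finset ι} {F : ι → α → ℝ}
    (hF : ∀ i ∈ s, p.BoundedOn (F i)) : p.BoundedOn fun a => ∑ i ∈ s, F i a := by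
  classical
  induction s using Finset.induction_on with
  | empty => simpa using BoundedOn.const (p := p) 0
  | insert i s hi ih =>
    simp only [Finset.sum_insert hi]
    exact (hF i (by simp)).add (ih fun j hj => hF j (by simp [hj]))

theorem BoundedOn.exp {p : PMF α} {F : α → ℝ} (hF : p.BoundedOn F) :
    p.BoundedOn fun a => Real.exp (F a) := by
  obtain ⟨M, hM⟩ := hF
  refine ⟨Real.exp M, fun a ha => ?_⟩
  rw [Real.abs_exp]
  exact Real.exp_le_exp.2 ((le_abs_self _).trans (hM a ha))

theorem summable_toReal (p : PMF α) : Summable fun a => (p a).toReal :=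
  ENNReal.summable_toReal p.tsum_coe_ne_top

theorem tsum_toReal (p : PMF α) : ∑' a, (p a).toReal = 1 := by
  rw [← ENNReal.tsum_toReal_eq p.apply_ne_top, p.tsum_coe, ENNReal.toReal_one]

theorem toReal_eq_zero_of_notMem {p : PMF α} {a : α} (h : a ∉ p.support) : (p a).toReal = 0 := by
  rw [(p.apply_eq_zero_iff a).2 h, ENNReal.toReal_zero]

theorem BoundedOn.summable {p : PMF α} {F : α → ℝ} (hF : p.BoundedOn F) :
    Summable fun a => (p a).toReal * F a := by
  obtain ⟨M, hM⟩ := hF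
  refine Summable.of_norm_bounded (p.summable_toReal.mul_right M) fun a => ?_
  rw [norm_mul, Real.norm_of_nonneg ENNReal.toReal_nonneg, Real.norm_eq_abs]
  by_cases ha : a ∈ p.support
  · exact mul_le_mul_of_nonneg_left (hM a ha) ENNReal.toReal_nonneg
  · simp [toReal_eq_zero_of_notMem ha]

end PMF

section Expect

open PMF

variable {α β : Type*} {p : PMF α} {F G : α → ℝ}

theorem pmfExpect_const (p : PMF α) (c : ℝ) : pmfExpect p (fun _ => c) = c := by
  rw [pmfExpect, tsum_mul_right, p.tsum_toReal, one_mul]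

theorem pmfExpect_add (hF : p.BoundedOn F) (hG : p.BoundedOn G) :
    pmfExpect p (fun a => F a + G a) = pmfExpect p F + pmfExpect p G := by
  simp only [pmfExpect, mul_add]
  exact hF.summable.tsum_add hG.summable

theorem pmfExpect_const_mul (p : PMF α) (c : ℝ) (F : α → ℝ) :
    pmfExpect p (fun a => c * F a) = c * pmfExpect p F := by
  simp only [pmfExpect, mul_left_comm _ c, tsum_mul_left]

theorem pmfExpect_sub (hF : p.BoundedOn F) (hG : p.BoundedOn G) :
    pmfExpect p (fun a => F a - G a) = pmfExpect p F - pmfExpect p G := by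
  simp only [pmfExpect, mul_sub]
  exact hF.summable.tsum_sub hG.summable

theorem pmfExpect_finset_sum {ι : Type*} {s : Finset ι} {F : ι → α → ℝ}
    (hF : ∀ i ∈ s, p.BoundedOn (F i)) :
    pmfExpect p (fun a => ∑ i ∈ s, F i a) = ∑ i ∈ s, pmfExpect p (F i) := by
  simp only [pmfExpect, Finset.mul_sum]
  exact Summable.tsum_finsetSum fun i hi => (hF i hi).summable

theorem pmfExpect_congr (h : ∀ a ∈ p.support, F a = G a) : pmfExpect p F = pmfExpect p G := by
  refine tsum_congr fun a => ?_
  by_cases ha : a ∈ p.support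
  · rw [h a ha]
  · simp [toReal_eq_zero_of_notMem ha]

theorem pmfExpect_mono (hF : p.BoundedOn F) (hG : p.BoundedOn G)
    (h : ∀ a ∈ p.support, F a ≤ G a) : pmfExpect p F ≤ pmfExpect p G := by
  refine hF.summable.tsum_le_tsum (fun a => ?_) hG.summable
  by_cases ha : a ∈ p.support
  · exact mul_le_mul_of_nonneg_left (h a ha) ENNReal.toReal_nonneg
  · simp [toReal_eq_zero_of_notMem ha]

theorem pmfExpect_nonneg (h : ∀ a, 0 ≤ F a) : 0 ≤ pmfExpect p F :=
  tsum_nonneg fun a => mul_nonneg ENNReal.toReal_nonneg (h a)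

theorem apply_mul_le_pmfExpect (hF : p.BoundedOn F) (h : ∀ a, 0 ≤ F a) (a : α) :
    (p a).toReal * F a ≤ pmfExpect p F :=
  hF.summable.le_tsum a fun b _ => mul_nonneg ENNReal.toReal_nonneg (h b)

theorem abs_pmfExpect_le {M : ℝ} (h : ∀ a ∈ p.support, |F a| ≤ M) : |pmfExpect p F| ≤ M := by
  have hF : p.BoundedOn F := ⟨M, h⟩
  rw [abs_le]
  constructor
  · rw [← pmfExpect_const p (-M)]
    exact pmfExpect_mono (.const _) hF fun a ha => (abs_le.1 (h a ha)).1
  · rw [← pmfExpect_const p M]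
    exact pmfExpect_mono hF (.const _) fun a ha => (abs_le.1 (h a ha)).2

theorem pmfExpect_pure (a : α) (F : α → ℝ) : pmfExpect (PMF.pure a) F = F a := by
  classical
  rw [pmfExpect, tsum_eq_single a]
  · simp
  · intro b hb
    simp [PMF.pure_apply_of_ne _ _ hb]

theorem pmfExpect_fintype [Fintype α] (p : PMF α) (F : α → ℝ) :
    pmfExpect p F = ∑ a, (p a).toReal * F a := tsum_fintype _

theorem PMF.BoundedOn.bind {f : α → PMF β} {F : β → ℝ} (hF : (p.bind f).BoundedOn F) :
    p.BoundedOn fun a => pmfExpect (f a) F := by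
  obtain ⟨M, hM⟩ := hF
  exact ⟨M, fun a ha => abs_pmfExpect_le fun b hb =>
    hM b ((PMF.mem_support_bind_iff _ _ _).2 ⟨a, ha, hb⟩)⟩

theorem PMF.BoundedOn.of_bind {f : α → PMF β} {F : β → ℝ} (hF : (p.bind f).BoundedOn F)
    {a : α} (ha : a ∈ p.support) : (f a).BoundedOn F :=
  hF.imp fun _ hM b hb => hM b ((PMF.mem_support_bind_iff _ _ _).2 ⟨a, ha, hb⟩)

/-- Fubini for series. The joint weights sum to one, so boundedness gives absolute summability.
Bounds on the support are the right hypothesis, because payoff estimates are controlled only along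
histories of positive probability. -/
theorem pmfExpect_bind {f : α → PMF β} {F : β → ℝ} (hF : (p.bind f).BoundedOn F) :
    pmfExpect (p.bind f) F = pmfExpect p fun a => pmfExpect (f a) F := by
  have h0 : ∀ x : α × β, 0 ≤ (p x.1).toReal * (f x.1 x.2).toReal := fun x =>
    mul_nonneg ENNReal.toReal_nonneg ENNReal.toReal_nonneg
  have hs : Summable fun x : α × β => (p x.1).toReal * (f x.1 x.2).toReal := by
    rw [summable_prod_of_nonneg h0]
    refine ⟨fun a => (f a).summable_toReal.mul_left (p a).toReal, ?_⟩
    refine p.summable_toReal.congr fun a => ?_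
    dsimp only
    rw [tsum_mul_left, tsum_toReal, mul_one]
  have hsF : Summable fun x : α × β => (p x.1).toReal * (f x.1 x.2).toReal * F x.2 := by
    obtain ⟨M, hM⟩ := hF
    refine Summable.of_norm_bounded (hs.mul_right M) fun x => ?_
    rw [norm_mul, Real.norm_of_nonneg (h0 x), Real.norm_eq_abs]
    by_cases ha : x.1 ∈ p.support
    · by_cases hb : x.2 ∈ (f x.1).support
      · exact mul_le_mul_of_nonneg_left
          (hM _ ((PMF.mem_support_bind_iff _ _ _).2 ⟨_, ha, hb⟩)) (h0 x)
      · simp [toReal_eq_zero_of_notMem hb]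
    · simp [toReal_eq_zero_of_notMem ha]
  have hb : ∀ b, (p.bind f b).toReal = ∑' a, (p a).toReal * (f a b).toReal := fun b => by
    rw [PMF.bind_apply, ENNReal.tsum_toReal_eq]
    · simp
    · exact fun a => ENNReal.mul_ne_top (p.apply_ne_top a) ((f a).apply_ne_top b)
  have hc := Summable.tsum_comm (f := fun a b => (p a).toReal * (f a b).toReal * F b) hsF
  calc pmfExpect (p.bind f) F
      = ∑' b, ∑' a, (p a).toReal * (f a b).toReal * F b := by
        simp only [pmfExpect, hb, tsum_mul_right]
    _ = ∑' a, ∑' b, (p a).toReal * (f a b).toReal * F b := hc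
    _ = _ := by simp only [pmfExpect, mul_assoc, tsum_mul_left]

theorem PMF.BoundedOn.map {f : α → β} {F : β → ℝ} (hF : (p.map f).BoundedOn F) :
    p.BoundedOn fun a => F (f a) :=
  hF.imp fun _ hM a ha => hM (f a) ((PMF.mem_support_map_iff _ _ _).2 ⟨a, ha, rfl⟩)

theorem pmfExpect_map {f : α → β} {F : β → ℝ} (hF : (p.map f).BoundedOn F) :
    pmfExpect (p.map f) F = pmfExpect p fun a => F (f a) := by
  rw [PMF.map] at hF ⊢
  rw [pmfExpect_bind hF]
  simp [pmfExpect_pure]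

/-- The mixture `s p + (1 - s) q` of two discrete distributions. -/
def PMF.mix (s : ℝ) (h0 : 0 ≤ s) (h1 : s ≤ 1) (p q : PMF α) : PMF α :=
  ⟨fun a => ENNReal.ofReal s * p a + ENNReal.ofReal (1 - s) * q a, by
    have h : ∑' a, (ENNReal.ofReal s * p a + ENNReal.ofReal (1 - s) * q a) = 1 := by
      rw [ENNReal.tsum_add, ENNReal.tsum_mul_left, ENNReal.tsum_mul_left, p.tsum_coe, q.tsum_coe,
        mul_one, mul_one, ← ENNReal.ofReal_add h0 (sub_nonneg.2 h1)]
      simp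
    rw [← h]
    exact ENNReal.summable.hasSum⟩

theorem pmfExpect_mix {s : ℝ} {h0 : 0 ≤ s} {h1 : s ≤ 1} {p q : PMF α}
    (hp : p.BoundedOn F) (hq : q.BoundedOn F) :
    pmfExpect (PMF.mix s h0 h1 p q) F = s * pmfExpect p F + (1 - s) * pmfExpect q F := by
  have h : ∀ a, (PMF.mix s h0 h1 p q a).toReal = s * (p a).toReal + (1 - s) * (q a).toReal := by
    intro a
    change (ENNReal.ofReal s * p a + ENNReal.ofReal (1 - s) * q a).toReal = _
    rw [ENNReal.toReal_add (ENNReal.mul_ne_top (by simp) (p.apply_ne_top a))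
      (ENNReal.mul_ne_top (by simp) (q.apply_ne_top a)), ENNReal.toReal_mul, ENNReal.toReal_mul,
      ENNReal.toReal_ofReal h0, ENNReal.toReal_ofReal (sub_nonneg.2 h1)]
  simp only [pmfExpect, h, add_mul, mul_assoc]
  rw [(hp.summable.mul_left s).tsum_add (hq.summable.mul_left (1 - s)), tsum_mul_left,
    tsum_mul_left]

/-- The distribution with density proportional to `exp F` with respect to `p`. -/
def PMF.tilt (p : PMF α) (F : α → ℝ) (hF : p.BoundedOn F) : PMF α :=
  PMF.normalize (fun a => p a * ENNReal.ofReal (Real.exp (F a)))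
    (by
      obtain ⟨a, ha⟩ := p.support_nonempty
      intro h
      have := ENNReal.tsum_eq_zero.1 h a
      rw [mul_eq_zero, ENNReal.ofReal_eq_zero] at this
      exact this.elim ha (not_le.2 (Real.exp_pos _)))
    (by
      have h := hF.exp.summable
      have h' : ∀ a, p a * ENNReal.ofReal (Real.exp (F a)) =
          ENNReal.ofReal ((p a).toReal * Real.exp (F a)) := fun a => by
        rw [ENNReal.ofReal_mul ENNReal.toReal_nonneg, ENNReal.ofReal_toReal (p.apply_ne_top a)]
      simp only [h']
      exact h.tsum_ofReal_ne_top)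

theorem pmfExpect_tilt (hF : p.BoundedOn F) (G : α → ℝ) :
    pmfExpect (p.tilt F hF) G =
      pmfExpect p (fun a => Real.exp (F a) * G a) / pmfExpect p (fun a => Real.exp (F a)) := by
  have hZ : (∑' a, p a * ENNReal.ofReal (Real.exp (F a))).toReal =
      pmfExpect p (fun a => Real.exp (F a)) := by
    rw [ENNReal.tsum_toReal_eq fun a => ENNReal.mul_ne_top (p.apply_ne_top a) (by simp)]
    simp [pmfExpect, ENNReal.toReal_ofReal (Real.exp_pos _).le]
  have h : ∀ a, (p.tilt F hF a).toReal = (p a).toReal * Real.exp (F a) *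
      (pmfExpect p (fun a => Real.exp (F a)))⁻¹ := fun a => by
    rw [PMF.tilt, PMF.normalize_apply, ENNReal.toReal_mul, ENNReal.toReal_inv, hZ,
      ENNReal.toReal_mul, ENNReal.toReal_ofReal (Real.exp_pos _).le]
  rw [div_eq_mul_inv, mul_comm, ← pmfExpect_const_mul]
  simp only [pmfExpect] at h ⊢
  simp only [h]
  exact tsum_congr fun a => by ring

theorem pmfExpect_exp_pos (hF : p.BoundedOn F) : 0 < pmfExpect p fun a => Real.exp (F a) := by
  obtain ⟨a, ha⟩ := p.support_nonempty
  refine lt_of_lt_of_le ?_ (apply_mul_le_pmfExpect hF.exp (fun a => (Real.exp_pos _).le) a)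
  exact mul_pos (ENNReal.toReal_pos ha (p.apply_ne_top a)) (Real.exp_pos _)

/-- Power mean inequality for exponential moments. -/
theorem log_pmfExpect_exp_div_mono (hF : p.BoundedOn F) {s t : ℝ} (hs : 0 < s) (hst : s ≤ t) :
    Real.log (pmfExpect p fun a => Real.exp (s * F a)) / s ≤
      Real.log (pmfExpect p fun a => Real.exp (t * F a)) / t := by
  have ht : 0 < t := hs.trans_le hst
  set A := pmfExpect p fun a => Real.exp (t * F a) with hA
  have hApos : 0 < A := pmfExpect_exp_pos (hF.const_mul t)
  have hr : s / t ≤ 1 := (div_le_one ht).2 hst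
  have key : pmfExpect p (fun a => Real.exp (s * F a)) ≤ A ^ (s / t) := by
    have h1 : ∀ a, Real.exp (s * F a) ≤
        A ^ (s / t) * ((1 - s / t) + s / t / A * Real.exp (t * F a)) := by
      intro a
      have hy : 0 < Real.exp (t * F a) / A := by positivity
      -- Bernoulli's inequality with exponent `s / t ≤ 1`, applied to the normalized exponential
      -- `exp (t F) / A`. That variable has mean one, so the linear bound integrates to exactly `A ^
      -- (s / t)`.
      have h2 := rpow_one_add_le_one_add_mul_self (s := Real.exp (t * F a) / A - 1)
        (by linarith) (p := s / t) (by positivity) hr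
      have h3 : Real.exp (s * F a) = A ^ (s / t) * (Real.exp (t * F a) / A) ^ (s / t) := by
        rw [← Real.mul_rpow hApos.le hy.le, mul_div_cancel₀ _ hApos.ne', ← Real.exp_mul]
        congr 1
        field_simp
      rw [h3]
      refine mul_le_mul_of_nonneg_left ?_ (by positivity)
      rw [add_sub_cancel] at h2
      refine h2.trans (le_of_eq ?_)
      ring
    refine (pmfExpect_mono (hF.const_mul s).exp
      (((BoundedOn.const _).add ((hF.const_mul t).exp.const_mul _)).const_mul _)
      fun a _ => h1 a).trans (le_of_eq ?_)
    rw [pmfExpect_const_mul, pmfExpect_add (.const _) ((hF.const_mul t).exp.const_mul _),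
      pmfExpect_const, pmfExpect_const_mul, ← hA]
    field_simp
    ring
  have := Real.log_le_log (pmfExpect_exp_pos (hF.const_mul s)) key
  rw [Real.log_rpow hApos] at this
  rw [div_le_iff₀ hs]
  refine this.trans (le_of_eq ?_)
  ring

/-- Combines `exp x ≤ 1 + x + x²` on `[-1, 1]` with `log y ≤ y - 1`. -/
theorem log_pmfExpect_exp_le (hF : p.BoundedOn F) (h : ∀ a ∈ p.support, |F a| ≤ 1) :
    Real.log (pmfExpect p fun a => Real.exp (F a)) ≤
      pmfExpect p F + pmfExpect p fun a => F a ^ 2 := by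
  have h1 : (pmfExpect p fun a => Real.exp (F a)) ≤
      1 + (pmfExpect p F + pmfExpect p fun a => F a ^ 2) := by
    rw [← pmfExpect_add hF (hF.pow 2)]
    conv_rhs => rw [← pmfExpect_const p 1]
    rw [← pmfExpect_add (.const 1) (hF.add (hF.pow 2))]
    refine pmfExpect_mono hF.exp ((BoundedOn.const 1).add (hF.add (hF.pow 2))) fun a ha => ?_
    have := (abs_le.1 (Real.abs_exp_sub_one_sub_id_le (h a ha))).2
    linarith
  have := Real.log_le_sub_one_of_pos (pmfExpect_exp_pos hF)
  linarith

end Expect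

end

/-! ### Second moment matrices and least squares estimation. -/

noncomputable section

section SecondMoment

open PMF Matrix

variable {α ι : Type*} {P : PMF α} {a : α → ι → ℝ}

theorem PMF.BoundedOn.coord (ha : ∀ x i, |a x i| ≤ 1) (i : ι) : P.BoundedOn fun x => a x i :=
  .of_le 1 fun x => ha x i

/-- The second moment matrix `E[a aᵀ]` of a random vector `a`. -/
def secondMoment (P : PMF α) (a : α → ι → ℝ) : Matrix ι ι ℝ :=
  Matrix.of fun i j => pmfExpect P fun x => a x i * a x j

theorem secondMoment_apply (i j : ι) :
    secondMoment P a i j = pmfExpect P fun x => a x i * a x j := rfl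

theorem secondMoment_transpose : (secondMoment P a)ᵀ = secondMoment P a := by
  ext i j
  simp only [transpose_apply, secondMoment_apply, mul_comm]

variable [Fintype ι]

theorem abs_dotProduct_le_sum {u v : ι → ℝ} (hv : ∀ i, |v i| ≤ 1) : |u ⬝ᵥ v| ≤ ∑ i, |u i| := by
  refine (Finset.abs_sum_le_sum_abs _ _).trans (Finset.sum_le_sum fun i _ => ?_)
  rw [abs_mul]
  exact mul_le_of_le_one_right (abs_nonneg _) (hv i)

theorem dotProduct_self_le_card {v : ι → ℝ} (hv : ∀ i, |v i| ≤ 1) :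
    v ⬝ᵥ v ≤ Fintype.card ι := by
  have : ∀ i ∈ Finset.univ, v i * v i ≤ 1 := fun i _ => by
    rw [← abs_mul_abs_self]
    exact mul_le_one₀ (hv i) (abs_nonneg _) (hv i)
  simpa [dotProduct] using Finset.sum_le_sum this

theorem PMF.BoundedOn.dotProduct (ha : ∀ x i, |a x i| ≤ 1) (w : ι → ℝ) :
    P.BoundedOn fun x => w ⬝ᵥ a x :=
  .of_le _ fun x => abs_dotProduct_le_sum (ha x)

theorem pmfExpect_dotProduct (ha : ∀ x i, |a x i| ≤ 1) (w : ι → ℝ) :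
    pmfExpect P (fun x => w ⬝ᵥ a x) = w ⬝ᵥ fun i => pmfExpect P fun x => a x i := by
  simp only [dotProduct]
  rw [pmfExpect_finset_sum fun i _ => (BoundedOn.coord ha i).const_mul _]
  simp only [pmfExpect_const_mul]

theorem dotProduct_secondMoment_mulVec (ha : ∀ x i, |a x i| ≤ 1) (v w : ι → ℝ) :
    v ⬝ᵥ secondMoment P a *ᵥ w = pmfExpect P fun x => (v ⬝ᵥ a x) * (w ⬝ᵥ a x) := by
  have h : ∀ i j, P.BoundedOn fun x => a x i * a x j := fun i j =>
    (BoundedOn.coord ha i).mul (BoundedOn.coord ha j)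
  have h1 : ∀ x, (v ⬝ᵥ a x) * (w ⬝ᵥ a x) = ∑ i, ∑ j, v i * w j * (a x i * a x j) := fun x => by
    simp only [dotProduct, Finset.sum_mul_sum]
    exact Finset.sum_congr rfl fun i _ => Finset.sum_congr rfl fun j _ => by ring
  simp only [h1]
  rw [pmfExpect_finset_sum fun i _ => BoundedOn.sum fun j _ => (h i j).const_mul _]
  simp only [dotProduct, mulVec, Finset.mul_sum]
  refine Finset.sum_congr rfl fun i _ => ?_
  rw [pmfExpect_finset_sum fun j _ => (h i j).const_mul _]
  refine Finset.sum_congr rfl fun j _ => ?_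
  rw [pmfExpect_const_mul, secondMoment_apply]
  ring

variable [DecidableEq ι] {κ : ℝ}

/-- A kernel vector `w` has `E (w · a)² = wᵀQw = 0`, and coercivity then forces `w = 0`. -/
theorem isUnit_det_secondMoment (ha : ∀ x i, |a x i| ≤ 1) (hκ : 0 < κ)
    (h : ∀ w : ι → ℝ, κ * (w ⬝ᵥ w) ≤ pmfExpect P fun x => (w ⬝ᵥ a x) ^ 2) :
    IsUnit (secondMoment P a).det := by
  rw [isUnit_iff_ne_zero]
  intro h0
  obtain ⟨w, hw, hQ⟩ := Matrix.exists_mulVec_eq_zero_iff.2 h0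
  have h1 := dotProduct_secondMoment_mulVec (P := P) ha w w
  rw [hQ, dotProduct_zero] at h1
  have h2 := h w
  simp only [sq, ← h1] at h2
  have h3 : w ⬝ᵥ w ≤ 0 := by
    by_contra! h4
    nlinarith
  have h5 : 0 ≤ w ⬝ᵥ w := Finset.sum_nonneg fun i _ => mul_self_nonneg (w i)
  exact hw (dotProduct_self_eq_zero.1 (le_antisymm h3 h5))

theorem dotProduct_secondMoment_inv_mulVec_comm (u v : ι → ℝ) :
    u ⬝ᵥ (secondMoment P a)⁻¹ *ᵥ v = ((secondMoment P a)⁻¹ *ᵥ u) ⬝ᵥ v := by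
  rw [dotProduct_mulVec, ← mulVec_transpose, transpose_nonsing_inv, secondMoment_transpose]

/-- The least squares estimator of a linear function is unbiased. -/
theorem pmfExpect_secondMoment_inv (ha : ∀ x i, |a x i| ≤ 1)
    (hQ : IsUnit (secondMoment P a).det) (v g : ι → ℝ) :
    pmfExpect P (fun z => (v ⬝ᵥ (secondMoment P a)⁻¹ *ᵥ a z) * (g ⬝ᵥ a z)) = v ⬝ᵥ g := by
  simp only [dotProduct_secondMoment_inv_mulVec_comm]
  rw [← dotProduct_secondMoment_mulVec ha, ← dotProduct_secondMoment_inv_mulVec_comm,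
    mulVec_mulVec, nonsing_inv_mul _ hQ, one_mulVec]

theorem pmfExpect_sq_secondMoment_inv (ha : ∀ x i, |a x i| ≤ 1)
    (hQ : IsUnit (secondMoment P a).det) (v : ι → ℝ) :
    pmfExpect P (fun z => (v ⬝ᵥ (secondMoment P a)⁻¹ *ᵥ a z) ^ 2) =
      v ⬝ᵥ (secondMoment P a)⁻¹ *ᵥ v := by
  rw [← pmfExpect_secondMoment_inv ha hQ v ((secondMoment P a)⁻¹ *ᵥ v)]
  simp only [sq, dotProduct_secondMoment_inv_mulVec_comm]

/-- The expectation is the trace of `Q⁻¹Q`. This keeps the variance term of the regret proportional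
to the dimension, whatever the distribution is. -/
theorem pmfExpect_dotProduct_secondMoment_inv (ha : ∀ x i, |a x i| ≤ 1)
    (hQ : IsUnit (secondMoment P a).det) :
    pmfExpect P (fun z => a z ⬝ᵥ (secondMoment P a)⁻¹ *ᵥ a z) = Fintype.card ι := by
  have h : ∀ i j, P.BoundedOn fun x => a x j * a x i := fun i j =>
    (BoundedOn.coord ha j).mul (BoundedOn.coord ha i)
  obtain ⟨c, hc⟩ : ∃ c : ι → ι → ℝ, ∀ i j, (secondMoment P a)⁻¹ i j = c i j :=
    ⟨_, fun _ _ => rfl⟩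
  have h1 : ∀ x, a x ⬝ᵥ (secondMoment P a)⁻¹ *ᵥ a x =
      ∑ i, ∑ j, c i j * (a x j * a x i) := fun x => by
    simp only [dotProduct, mulVec, Finset.mul_sum, hc]
    exact Finset.sum_congr rfl fun i _ => Finset.sum_congr rfl fun j _ => by ring
  simp only [h1]
  rw [pmfExpect_finset_sum fun i _ => BoundedOn.sum fun j _ => (h i j).const_mul _]
  have h2 : ((secondMoment P a)⁻¹ * secondMoment P a).trace = Fintype.card ι := by
    rw [nonsing_inv_mul _ hQ, trace_one]
  rw [← h2, trace]
  refine Finset.sum_congr rfl fun i _ => ?_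
  rw [pmfExpect_finset_sum fun j _ => (h i j).const_mul _, diag_apply, mul_apply]
  simp only [pmfExpect_const_mul, secondMoment_apply, hc]

theorem abs_dotProduct_secondMoment_inv_le (ha : ∀ x i, |a x i| ≤ 1) (hκ : 0 < κ)
    (h : ∀ w : ι → ℝ, κ * (w ⬝ᵥ w) ≤ pmfExpect P fun x => (w ⬝ᵥ a x) ^ 2)
    {u v : ι → ℝ} (hu : ∀ i, |u i| ≤ 1) (hv : ∀ i, |v i| ≤ 1) :
    |v ⬝ᵥ (secondMoment P a)⁻¹ *ᵥ u| ≤ Fintype.card ι / κ := by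
  have hQ := isUnit_det_secondMoment ha hκ h
  set w := (secondMoment P a)⁻¹ *ᵥ u with hw
  have hQw : secondMoment P a *ᵥ w = u := by
    rw [hw, mulVec_mulVec, mul_nonsing_inv _ hQ, one_mulVec]
  have h1 : κ * (w ⬝ᵥ w) ≤ w ⬝ᵥ u := by
    rw [← hQw, dotProduct_secondMoment_mulVec ha]
    simpa only [sq] using h w
  have hsq : ∀ x y : ι → ℝ, ∀ s : ℝ, 0 ≤ x ⬝ᵥ x + 2 * s * (x ⬝ᵥ y) + s ^ 2 * (y ⬝ᵥ y) := by
    intro x y s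
    have : (x + s • y) ⬝ᵥ (x + s • y) = x ⬝ᵥ x + 2 * s * (x ⬝ᵥ y) + s ^ 2 * (y ⬝ᵥ y) := by
      simp only [add_dotProduct, dotProduct_add, smul_dotProduct, dotProduct_smul, smul_eq_mul,
        dotProduct_comm y x]
      ring
    rw [← this]
    exact Finset.sum_nonneg fun i _ => mul_self_nonneg _
  have hu' := dotProduct_self_le_card hu
  have hv' := dotProduct_self_le_card hv
  -- With `κ |w|² ≤ w · u`, the square of `u - κ w` yields `κ (w · u) ≤ |u|²`, hence `κ² |w|² ≤ card
  -- ι`. The squares of `v ± κ w` then bound `2 κ |v · w|` by `2 card ι`.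
  have h2 := hsq u w (-κ)
  rw [dotProduct_comm u w] at h2
  have h3 := hsq v w κ
  have h4 := hsq v w (-κ)
  rw [abs_le, ← neg_div, div_le_iff₀ hκ, le_div_iff₀ hκ]
  have h5 : κ * (κ * (w ⬝ᵥ w)) ≤ κ * (w ⬝ᵥ u) := mul_le_mul_of_nonneg_left h1 hκ.le
  constructor <;> linarith

end SecondMoment

end

/-! ### Exponential weights: one round of the potential argument. -/

noncomputable section

open PMF Matrix

theorem abs_log_pmfExpect_exp_le {α : Type*} {p : PMF α} {F : α → ℝ} {M : ℝ}
    (h : ∀ a ∈ p.support, |F a| ≤ M) : |Real.log (pmfExpect p fun a => Real.exp (F a))| ≤ M := by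
  have hF : p.BoundedOn F := ⟨M, h⟩
  have hpos := pmfExpect_exp_pos hF
  rw [abs_le, Real.le_log_iff_exp_le hpos, Real.log_le_iff_le_exp hpos]
  constructor
  · rw [← pmfExpect_const p (Real.exp (-M))]
    exact pmfExpect_mono (.const _) hF.exp fun a ha => Real.exp_le_exp.2 (abs_le.1 (h a ha)).1
  · rw [← pmfExpect_const p (Real.exp M)]
    exact pmfExpect_mono hF.exp (.const _) fun a ha => Real.exp_le_exp.2 (abs_le.1 (h a ha)).2

/-- The partition function dominates each of its terms; `-log (p a)` will be the price of competing
with the atom `a`. -/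
theorem log_add_mul_le_log_pmfExpect_exp {α : Type*} {p : PMF α} {F : α → ℝ}
    (hF : p.BoundedOn F) {a : α} (ha : a ∈ p.support) :
    F a + Real.log (p a).toReal ≤ Real.log (pmfExpect p fun a => Real.exp (F a)) := by
  have hp : 0 < (p a).toReal := ENNReal.toReal_pos ha (p.apply_ne_top a)
  rw [Real.le_log_iff_exp_le (pmfExpect_exp_pos hF), Real.exp_add, Real.exp_log hp, mul_comm]
  exact apply_mul_le_pmfExpect hF.exp (fun a => (Real.exp_pos _).le) a

/-- The data of the exponential weights algorithm for linear bandits on a set `α` of actions with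
coordinates in the cube: a prior over actions, an exploration distribution and learning rates. -/
structure ExpWeights (α ι : Type*) [Fintype ι] where
  coord : α → ι → ℝ
  abs_coord_le : ∀ x i, |coord x i| ≤ 1
  prior : PMF α
  explore : PMF α
  dim : ℝ
  one_le_dim : 1 ≤ dim
  card_le_dim : Fintype.card ι ≤ dim
  coercive : ∀ w : ι → ℝ, w ⬝ᵥ w ≤ dim * pmfExpect explore fun x => (w ⬝ᵥ coord x) ^ 2
  bound : ℝ
  bound_pos : 0 < bound
  rate : ℕ → ℝ
  rate_pos : ∀ n, 0 < rate n
  rate_anti : Antitone rate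
  rate_le : ∀ n, rate n * dim ^ 2 * bound ≤ 1 / 2

namespace ExpWeights

variable {α ι : Type*} [Fintype ι] (A : ExpWeights α ι)

/-- The exploration probability in round `n`. -/
def mixRate (n : ℕ) : ℝ := A.rate n * A.dim ^ 2 * A.bound

theorem dim_pos : 0 < A.dim := one_pos.trans_le A.one_le_dim

theorem mixRate_pos (n : ℕ) : 0 < A.mixRate n := by
  have := A.dim_pos
  have := A.bound_pos
  have := A.rate_pos n
  unfold mixRate
  positivity

theorem mixRate_le (n : ℕ) : A.mixRate n ≤ 1 / 2 := A.rate_le n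

theorem bounded_dotProduct (p : PMF α) (w : ι → ℝ) : p.BoundedOn fun x => w ⬝ᵥ A.coord x :=
  BoundedOn.dotProduct A.abs_coord_le w

/-- The exponential weights distribution in round `n` given the payoff estimate `θ`. -/
def weights (n : ℕ) (θ : ι → ℝ) : PMF α :=
  A.prior.tilt (fun x => A.rate n * (θ ⬝ᵥ A.coord x)) ((A.bounded_dotProduct _ θ).const_mul _)

/-- The distribution of the action in round `n` given the payoff estimate `θ`. -/
def law (n : ℕ) (θ : ι → ℝ) : PMF α :=
  PMF.mix (A.mixRate n) (A.mixRate_pos n).le ((A.mixRate_le n).trans (by norm_num))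
    A.explore (A.weights n θ)

/-- The log-partition potential with learning rate `η`. -/
def potential (η : ℝ) (θ : ι → ℝ) : ℝ :=
  Real.log (pmfExpect A.prior fun x => Real.exp (η * (θ ⬝ᵥ A.coord x))) / η

theorem pmfExpect_law {n : ℕ} {θ : ι → ℝ} {F : α → ℝ} (M : ℝ) (hF : ∀ a, |F a| ≤ M) :
    pmfExpect (A.law n θ) F =
      A.mixRate n * pmfExpect A.explore F + (1 - A.mixRate n) * pmfExpect (A.weights n θ) F :=
  pmfExpect_mix (.of_le M hF) (.of_le M hF)

theorem pmfExpect_law_of_bounded {n : ℕ} {θ : ι → ℝ} {F : α → ℝ} (hF : ∃ M, ∀ a, |F a| ≤ M) :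
    pmfExpect (A.law n θ) F =
      A.mixRate n * pmfExpect A.explore F + (1 - A.mixRate n) * pmfExpect (A.weights n θ) F :=
  A.pmfExpect_law hF.choose hF.choose_spec

theorem sq_dotProduct_bounded (w : ι → ℝ) : ∃ M, ∀ x, |(w ⬝ᵥ A.coord x) ^ 2| ≤ M := by
  refine ⟨(∑ i, |w i|) ^ 2, fun x => ?_⟩
  rw [abs_pow]
  exact pow_le_pow_left₀ (abs_nonneg _) (abs_dotProduct_le_sum (A.abs_coord_le x)) 2

theorem law_coercive (n : ℕ) (θ w : ι → ℝ) :
    A.mixRate n / A.dim * (w ⬝ᵥ w) ≤ pmfExpect (A.law n θ) fun x => (w ⬝ᵥ A.coord x) ^ 2 := by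
  rw [A.pmfExpect_law_of_bounded (A.sq_dotProduct_bounded w), div_mul_eq_mul_div,
    div_le_iff₀ A.dim_pos]
  have h1 := mul_le_mul_of_nonneg_left (A.coercive w) (A.mixRate_pos n).le
  have h2 : 0 ≤ pmfExpect (A.weights n θ) fun x => (w ⬝ᵥ A.coord x) ^ 2 :=
    pmfExpect_nonneg fun x => sq_nonneg _
  have h3 := mul_nonneg (mul_nonneg (sub_nonneg.2 ((A.mixRate_le n).trans (by norm_num :
    (1 / 2 : ℝ) ≤ 1))) h2) A.dim_pos.le
  linarith

/-- The exploration probability is at most one half, so the played law dominates half of the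
weights. -/
theorem pmfExpect_weights_sq_le (n : ℕ) (θ w : ι → ℝ) :
    (pmfExpect (A.weights n θ) fun x => (w ⬝ᵥ A.coord x) ^ 2) ≤
      2 * pmfExpect (A.law n θ) fun x => (w ⬝ᵥ A.coord x) ^ 2 := by
  rw [A.pmfExpect_law_of_bounded (A.sq_dotProduct_bounded w)]
  have h1 : 0 ≤ pmfExpect A.explore fun x => (w ⬝ᵥ A.coord x) ^ 2 :=
    pmfExpect_nonneg fun x => sq_nonneg _
  have h2 : 0 ≤ pmfExpect (A.weights n θ) fun x => (w ⬝ᵥ A.coord x) ^ 2 :=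
    pmfExpect_nonneg fun x => sq_nonneg _
  have h3 := mul_nonneg (A.mixRate_pos n).le h1
  have h4 := mul_nonneg (sub_nonneg.2 (A.mixRate_le n)) h2
  linarith

theorem abs_potential_le {η M : ℝ} (hη : 0 < η) {θ : ι → ℝ}
    (h : ∀ x, |θ ⬝ᵥ A.coord x| ≤ M) : |A.potential η θ| ≤ M := by
  rw [potential, abs_div, abs_of_pos hη, div_le_iff₀ hη]
  refine abs_log_pmfExpect_exp_le fun x _ => ?_
  rw [abs_mul, abs_of_pos hη, mul_comm]
  exact mul_le_mul_of_nonneg_right (h x) hη.le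

theorem exists_abs_dotProduct_le (θ : ι → ℝ) : ∃ M, ∀ x, |θ ⬝ᵥ A.coord x| ≤ M :=
  ⟨_, fun x => abs_dotProduct_le_sum (A.abs_coord_le x)⟩

variable [DecidableEq ι]

/-- The least squares direction of the action `z` in round `n`. -/
def direction (n : ℕ) (θ : ι → ℝ) (z : α) : ι → ℝ :=
  (secondMoment (A.law n θ) A.coord)⁻¹ *ᵥ A.coord z

theorem isUnit_det (n : ℕ) (θ : ι → ℝ) : IsUnit (secondMoment (A.law n θ) A.coord).det :=
  isUnit_det_secondMoment A.abs_coord_le (div_pos (A.mixRate_pos n) A.dim_pos)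
    (A.law_coercive n θ)

/-- This fixes the size of the exploration probability. The coercivity constant of the law is
`mixRate / dim`, so the general bound reads `card ι * dim / (rate * dim² * bound)`. Increments of
the exponent are then at most one, as the second-order expansion needs. -/
theorem abs_coord_direction_le (n : ℕ) (θ : ι → ℝ) (x z : α) :
    |A.coord x ⬝ᵥ A.direction n θ z| ≤ (A.rate n * A.bound)⁻¹ := by
  refine (abs_dotProduct_secondMoment_inv_le A.abs_coord_le
    (div_pos (A.mixRate_pos n) A.dim_pos) (A.law_coercive n θ) (A.abs_coord_le z)
    (A.abs_coord_le x)).trans ?_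
  have h0 := A.rate_pos n
  have h1 := A.dim_pos
  have h2 := A.bound_pos
  rw [mixRate, div_le_iff₀ (by positivity)]
  refine A.card_le_dim.trans (le_of_eq ?_)
  field_simp

/-- Shifting the estimate multiplies the partition function by the exponential moment of the
increment under the current weights, which is expanded to second order. The quadratic term passes
from the weights to the law at a factor two, and under the law it equals `zᵀQ⁻¹z`. -/
theorem potential_step (n : ℕ) (θ : ι → ℝ) (z : α) {r : ℝ} (hr : |r| ≤ A.bound) :
    A.potential (A.rate n) (θ + r • A.direction n θ z) ≤ A.potential (A.rate n) θ +
      r * ((fun i => pmfExpect (A.weights n θ) fun x => A.coord x i) ⬝ᵥ A.direction n θ z) +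
      2 * A.rate n * A.bound ^ 2 * (A.coord z ⬝ᵥ A.direction n θ z) := by
  set η := A.rate n with hη
  have hηpos : 0 < η := A.rate_pos n
  set d := A.direction n θ z with hd
  set q := A.weights n θ with hq
  have hbd : q.BoundedOn fun x => η * r * (d ⬝ᵥ A.coord x) :=
    (A.bounded_dotProduct q d).const_mul _
  have hθ : A.prior.BoundedOn fun x => η * (θ ⬝ᵥ A.coord x) :=
    (A.bounded_dotProduct _ θ).const_mul _
  have h1 : (pmfExpect A.prior fun x => Real.exp (η * ((θ + r • d) ⬝ᵥ A.coord x))) =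
      (pmfExpect A.prior fun x => Real.exp (η * (θ ⬝ᵥ A.coord x))) *
        pmfExpect q fun x => Real.exp (η * r * (d ⬝ᵥ A.coord x)) := by
    rw [hq, weights, pmfExpect_tilt, mul_div_cancel₀ _ (pmfExpect_exp_pos hθ).ne']
    refine pmfExpect_congr fun x _ => ?_
    rw [← Real.exp_add, add_dotProduct, smul_dotProduct, smul_eq_mul, ← hη]
    congr 1
    ring
  have h2 : ∀ x ∈ q.support, |η * r * (d ⬝ᵥ A.coord x)| ≤ 1 := fun x _ => by
    have h3 := A.abs_coord_direction_le n θ x z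
    rw [← hd, ← hη, dotProduct_comm] at h3
    rw [abs_mul, abs_mul, abs_of_pos hηpos]
    have h4 := mul_le_mul (mul_le_mul_of_nonneg_left hr hηpos.le) h3 (abs_nonneg _)
      (mul_nonneg hηpos.le A.bound_pos.le)
    rwa [mul_inv_cancel₀ (mul_pos hηpos A.bound_pos).ne'] at h4
  have h3 := log_pmfExpect_exp_le hbd h2
  rw [pmfExpect_const_mul] at h3
  simp only [mul_pow] at h3
  rw [pmfExpect_const_mul, pmfExpect_dotProduct A.abs_coord_le] at h3
  have h4 := A.pmfExpect_weights_sq_le n θ d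
  have h5 : (pmfExpect (A.law n θ) fun x => (d ⬝ᵥ A.coord x) ^ 2) = A.coord z ⬝ᵥ d := by
    rw [hd, direction, ← pmfExpect_sq_secondMoment_inv A.abs_coord_le (A.isUnit_det n θ)]
    simp only [dotProduct_secondMoment_inv_mulVec_comm]
  rw [h5, ← hq] at h4
  have hr2 : r ^ 2 ≤ A.bound ^ 2 := sq_le_sq' (abs_le.1 hr).1 (abs_le.1 hr).2
  have h6 : η ^ 2 * r ^ 2 * (pmfExpect q fun x => (d ⬝ᵥ A.coord x) ^ 2) ≤
      η ^ 2 * A.bound ^ 2 * (2 * (A.coord z ⬝ᵥ d)) := by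
    refine mul_le_mul (mul_le_mul_of_nonneg_left hr2 (sq_nonneg _)) h4
      (pmfExpect_nonneg fun x => sq_nonneg _) (by positivity)
  rw [potential, potential, h1, Real.log_mul (pmfExpect_exp_pos hθ).ne'
    (pmfExpect_exp_pos hbd).ne', add_div, add_assoc]
  refine add_le_add le_rfl ?_
  rw [div_le_iff₀ hηpos, dotProduct_comm _ d]
  refine (h3.trans (add_le_add le_rfl h6)).trans (le_of_eq ?_)
  ring

theorem abs_dotProduct_direction_le (n : ℕ) (θ u : ι → ℝ) :
    ∃ M, ∀ z, |u ⬝ᵥ A.direction n θ z| ≤ M := by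
  refine ⟨∑ i, |((secondMoment (A.law n θ) A.coord)⁻¹ *ᵥ u) i|, fun z => ?_⟩
  rw [direction, dotProduct_secondMoment_inv_mulVec_comm]
  exact abs_dotProduct_le_sum (A.abs_coord_le z)

theorem abs_update_le (n : ℕ) {θ : ι → ℝ} {M : ℝ} (h : ∀ x, |θ ⬝ᵥ A.coord x| ≤ M) (z : α)
    {r : ℝ} (hr : |r| ≤ A.bound) (x : α) :
    |(θ + r • A.direction n θ z) ⬝ᵥ A.coord x| ≤ M + (A.rate n)⁻¹ := by
  rw [add_dotProduct, smul_dotProduct, smul_eq_mul]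
  refine (abs_add_le _ _).trans (add_le_add (h x) ?_)
  rw [abs_mul, dotProduct_comm]
  refine (mul_le_mul hr (A.abs_coord_direction_le n θ x z) (abs_nonneg _)
    A.bound_pos.le).trans (le_of_eq ?_)
  have h0 := A.rate_pos n
  have h2 := A.bound_pos
  field_simp

section Feedback

variable {g : ι → ℝ} {fb : α → PMF ℝ}

theorem pmfExpect_update (n : ℕ) (θ : ι → ℝ) (hfb : ∀ z, ∀ r ∈ (fb z).support, |r| ≤ A.bound)
    (hg : ∀ z, pmfExpect (fb z) id = g ⬝ᵥ A.coord z) (x : α) :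
    (pmfExpect (A.law n θ) fun z => pmfExpect (fb z) fun r =>
      (θ + r • A.direction n θ z) ⬝ᵥ A.coord x) = θ ⬝ᵥ A.coord x + g ⬝ᵥ A.coord x := by
  have h1 : ∀ z, (pmfExpect (fb z) fun r => (θ + r • A.direction n θ z) ⬝ᵥ A.coord x) =
      θ ⬝ᵥ A.coord x + (A.coord x ⬝ᵥ A.direction n θ z) * (g ⬝ᵥ A.coord z) := fun z => by
    have hid : (fb z).BoundedOn fun r => r := ⟨_, hfb z⟩
    simp only [add_dotProduct, smul_dotProduct, smul_eq_mul]
    simp only [mul_comm _ (A.direction n θ z ⬝ᵥ A.coord x)]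
    rw [pmfExpect_add (.const _) (hid.const_mul _), pmfExpect_const, pmfExpect_const_mul,
      dotProduct_comm (A.direction n θ z)]
    exact congrArg _ (congrArg _ (hg z))
  simp only [h1]
  rw [pmfExpect_add (.const _), pmfExpect_const]
  · rw [dotProduct_comm g]
    exact congrArg _ (pmfExpect_secondMoment_inv A.abs_coord_le (A.isUnit_det n θ) _ _)
  · obtain ⟨M, hM⟩ := A.abs_dotProduct_direction_le n θ (A.coord x)
    exact (BoundedOn.of_le M hM).mul (A.bounded_dotProduct _ g)

/-- Averaging `potential_step` turns its linear term into the mean payoff under the weights, by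
unbiasedness, and its quadratic term into a multiple of the dimension, by the trace identity.
Passing from the weights to the played law costs at most `2 * mixRate * bound`. Each of the two
errors is at most `2 * dim² * bound² * rate`. -/
theorem pmfExpect_potential_update_le (n : ℕ) (θ : ι → ℝ)
    (hfb : ∀ z, ∀ r ∈ (fb z).support, |r| ≤ A.bound)
    (hg : ∀ z, pmfExpect (fb z) id = g ⬝ᵥ A.coord z) :
    (pmfExpect (A.law n θ) fun z => pmfExpect (fb z) fun r =>
      A.potential (A.rate n) (θ + r • A.direction n θ z)) ≤
    A.potential (A.rate n) θ + (pmfExpect (A.law n θ) fun z => g ⬝ᵥ A.coord z) +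
      4 * A.dim ^ 2 * A.bound ^ 2 * A.rate n := by
  have hη := A.rate_pos n
  obtain ⟨M, hM⟩ := A.exists_abs_dotProduct_le θ
  have hgB : ∀ x, |g ⬝ᵥ A.coord x| ≤ A.bound := fun x => by
    rw [← hg]
    exact abs_pmfExpect_le (hfb x)
  have hpot : ∀ z, ∀ r ∈ (fb z).support,
      |A.potential (A.rate n) (θ + r • A.direction n θ z)| ≤ M + (A.rate n)⁻¹ := fun z r hr =>
    A.abs_potential_le hη (A.abs_update_le n hM z (hfb z r hr))
  set m : ι → ℝ := fun i => pmfExpect (A.weights n θ) fun x => A.coord x i with hm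
  obtain ⟨N, hN⟩ := A.abs_dotProduct_direction_le n θ m
  have hself : ∀ z, |A.coord z ⬝ᵥ A.direction n θ z| ≤ (A.rate n * A.bound)⁻¹ := fun z =>
    A.abs_coord_direction_le n θ z z
  have h1 : ∀ z, (pmfExpect (fb z) fun r => A.potential (A.rate n) (θ + r • A.direction n θ z)) ≤
      A.potential (A.rate n) θ + (m ⬝ᵥ A.direction n θ z) * (g ⬝ᵥ A.coord z) +
      2 * A.rate n * A.bound ^ 2 * (A.coord z ⬝ᵥ A.direction n θ z) := fun z => by
    have hid : (fb z).BoundedOn id := ⟨_, hfb z⟩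
    have h2 : (fb z).BoundedOn fun r => A.potential (A.rate n) θ +
        (m ⬝ᵥ A.direction n θ z) * id r +
        2 * A.rate n * A.bound ^ 2 * (A.coord z ⬝ᵥ A.direction n θ z) :=
      ((BoundedOn.const _).add (hid.const_mul _)).add (.const _)
    refine (pmfExpect_mono ⟨_, hpot z⟩ h2 fun r hr => ?_).trans (le_of_eq ?_)
    · refine (A.potential_step n θ z (hfb z r hr)).trans (le_of_eq ?_)
      rw [mul_comm r]
      rfl
    · rw [pmfExpect_add ((BoundedOn.const _).add (hid.const_mul _)) (.const _),
        pmfExpect_add (.const _) (hid.const_mul _), pmfExpect_const, pmfExpect_const,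
        pmfExpect_const_mul, hg]
  have hb1 : (A.law n θ).BoundedOn fun z => (m ⬝ᵥ A.direction n θ z) * (g ⬝ᵥ A.coord z) :=
    (BoundedOn.of_le N hN).mul (.of_le _ hgB)
  have hb2 : (A.law n θ).BoundedOn fun z =>
      2 * A.rate n * A.bound ^ 2 * (A.coord z ⬝ᵥ A.direction n θ z) :=
    (BoundedOn.of_le _ hself).const_mul _
  refine (pmfExpect_mono (.of_le _ fun z => abs_pmfExpect_le (hpot z))
    (((BoundedOn.const _).add hb1).add hb2) fun z _ => h1 z).trans ?_
  rw [pmfExpect_add ((BoundedOn.const _).add hb1) hb2, pmfExpect_add (.const _) hb1,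
    pmfExpect_const, pmfExpect_const_mul]
  have h3 : (pmfExpect (A.law n θ) fun z => (m ⬝ᵥ A.direction n θ z) * (g ⬝ᵥ A.coord z)) =
      m ⬝ᵥ g :=
    pmfExpect_secondMoment_inv A.abs_coord_le (A.isUnit_det n θ) _ _
  have h4 : (pmfExpect (A.law n θ) fun z => A.coord z ⬝ᵥ A.direction n θ z) = Fintype.card ι :=
    pmfExpect_dotProduct_secondMoment_inv A.abs_coord_le (A.isUnit_det n θ)
  have h5 : m ⬝ᵥ g = pmfExpect (A.weights n θ) fun x => g ⬝ᵥ A.coord x := by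
    rw [pmfExpect_dotProduct A.abs_coord_le, dotProduct_comm]
  have h6 := A.pmfExpect_law (n := n) (θ := θ) A.bound hgB
  have h7 := abs_le.1 (abs_pmfExpect_le (p := A.weights n θ) fun x _ => hgB x)
  have h8 := abs_le.1 (abs_pmfExpect_le (p := A.explore) fun x _ => hgB x)
  rw [h3, h4, h5]
  have hγ : A.mixRate n = A.rate n * A.dim ^ 2 * A.bound := rfl
  have h9 : A.mixRate n * ((pmfExpect (A.weights n θ) fun x => g ⬝ᵥ A.coord x) -
      pmfExpect A.explore fun x => g ⬝ᵥ A.coord x) ≤ A.mixRate n * (2 * A.bound) :=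
    mul_le_mul_of_nonneg_left (by linarith) (A.mixRate_pos n).le
  have h10 : 2 * A.rate n * A.bound ^ 2 * (Fintype.card ι : ℝ) ≤
      2 * A.rate n * A.bound ^ 2 * A.dim ^ 2 := by
    refine mul_le_mul_of_nonneg_left ?_ (by positivity)
    have := A.one_le_dim
    have := A.card_le_dim
    nlinarith
  rw [hγ] at h9 h6
  nlinarith

end Feedback

end ExpWeights

end

/-! ### Expected regret of exponential weights over many rounds. -/

noncomputable section

open PMF Matrix

theorem abs_feedback_mean_le {E : Type*} [AddCommGroup E] [Module ℝ E] {X : Set E} {B : ℝ}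
    (env : BanditEnvironment X B) (t : ℕ) (z : X) : |env.payoff t z| ≤ B := by
  rw [← env.unbiased]
  exact abs_pmfExpect_le (env.bounded t z)

namespace BanditEnvironment

variable {E : Type*} [AddCommGroup E] [Module ℝ E] {X : Set E} {B : ℝ}
  (env : BanditEnvironment X B) (R : Recommender X)

theorem mem_support_play_succ {n : ℕ} {h : List (X × ℝ)} :
    h ∈ (env.play R (n + 1)).support ↔ ∃ h' ∈ (env.play R n).support,
      ∃ z ∈ (R.recommend h').support, ∃ r ∈ (env.feedback n z).support, h = (z, r) :: h' := by
  simp only [play, PMF.mem_support_bind_iff, PMF.mem_support_pure_iff]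

theorem length_of_mem_support_play {n : ℕ} :
    ∀ {h : List (X × ℝ)}, h ∈ (env.play R n).support → h.length = n := by
  induction n with
  | zero =>
    intro h hh
    rw [play, PMF.mem_support_pure_iff] at hh
    simp [hh]
  | succ n ih =>
    intro h hh
    obtain ⟨h', hh', z, _, r, _, rfl⟩ := (env.mem_support_play_succ R).1 hh
    simp [ih hh']

theorem pmfExpect_play_succ {n : ℕ} {F : List (X × ℝ) → ℝ}
    (hF : (env.play R (n + 1)).BoundedOn F) :
    pmfExpect (env.play R (n + 1)) F = pmfExpect (env.play R n) fun h =>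
      pmfExpect (R.recommend h) fun z => pmfExpect (env.feedback n z) fun r => F ((z, r) :: h) := by
  rw [play] at hF ⊢
  rw [pmfExpect_bind hF]
  refine pmfExpect_congr fun h hh => ?_
  have hF1 := hF.of_bind hh
  rw [pmfExpect_bind hF1]
  refine pmfExpect_congr fun z hz => ?_
  have hF2 := hF1.of_bind hz
  rw [pmfExpect_bind hF2]
  simp only [pmfExpect_pure]

theorem boundedOn_play_succ {n : ℕ} {F : List (X × ℝ) → ℝ}
    (hF : (env.play R (n + 1)).BoundedOn F) :
    (env.play R n).BoundedOn fun h =>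
      pmfExpect (R.recommend h) fun z => pmfExpect (env.feedback n z) fun r => F ((z, r) :: h) := by
  obtain ⟨M, hM⟩ := hF
  refine ⟨M, fun h hh => abs_pmfExpect_le fun z hz => abs_pmfExpect_le fun r hr => hM _ ?_⟩
  exact (env.mem_support_play_succ R).2 ⟨h, hh, z, hz, r, hr, rfl⟩

theorem abs_cumPayoff_le (h : List (X × ℝ)) : |env.cumPayoff h| ≤ h.length * B := by
  induction h with
  | nil => simp [cumPayoff]
  | cons p h ih =>
    rw [cumPayoff, List.length_cons, Nat.cast_add_one]
    have h1 := abs_feedback_mean_le env h.length p.1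
    refine (abs_add_le _ _).trans ?_
    linarith

theorem boundedOn_cumPayoff (n : ℕ) : (env.play R n).BoundedOn env.cumPayoff :=
  ⟨n * B, fun h hh => env.length_of_mem_support_play R hh ▸ env.abs_cumPayoff_le h⟩

theorem pmfExpect_cumPayoff_succ (n : ℕ) :
    pmfExpect (env.play R (n + 1)) env.cumPayoff = pmfExpect (env.play R n) env.cumPayoff +
      pmfExpect (env.play R n) fun h => pmfExpect (R.recommend h) fun z => env.payoff n z := by
  have hb : ∀ h, (R.recommend h).BoundedOn fun z => env.payoff n z := fun h =>
    .of_le B fun z => abs_feedback_mean_le env n z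
  rw [env.pmfExpect_play_succ R (env.boundedOn_cumPayoff R _),
    ← pmfExpect_add (env.boundedOn_cumPayoff R n)
      (.of_le B fun h => abs_pmfExpect_le fun z _ => abs_feedback_mean_le env n z)]
  refine pmfExpect_congr fun h hh => ?_
  simp only [cumPayoff, pmfExpect_const, env.length_of_mem_support_play R hh]
  rw [pmfExpect_add (hb h) (.const _), pmfExpect_const, add_comm]

theorem regret_le_two_mul (T : ℕ) (x : X) :
    ∑ t ∈ Finset.range T, env.payoff t x - pmfExpect (env.play R T) env.cumPayoff ≤
      2 * B * T := by
  have h1 : ∑ t ∈ Finset.range T, env.payoff t x ≤ T * B := by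
    refine (Finset.sum_le_sum fun t _ => (abs_le.1 (abs_feedback_mean_le env t x)).2).trans ?_
    simp
  have h2 := abs_le.1 (abs_pmfExpect_le (p := env.play R T) (F := env.cumPayoff) fun h hh =>
    (env.abs_cumPayoff_le h).trans_eq (by rw [env.length_of_mem_support_play R hh]))
  linarith

end BanditEnvironment

namespace ExpWeights

variable {E : Type*} [AddCommGroup E] [Module ℝ E] {X : Set E} {ι : Type*} [Fintype ι]
  [DecidableEq ι] (A : ExpWeights X ι)

/-- The estimate of the cumulative payoff after a history. -/
def estimate : List (X × ℝ) → ι → ℝ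
  | [] => 0
  | (z, r) :: h => estimate h + r • A.direction h.length (estimate h) z

/-- The exponential weights recommender. -/
def recommender : Recommender X where
  recommend h := A.law h.length (A.estimate h)

variable (env : BanditEnvironment X A.bound)

theorem abs_estimate_le {n : ℕ} : ∀ {h : List (X × ℝ)}, h ∈ (env.play A.recommender n).support →
    ∀ x, |A.estimate h ⬝ᵥ A.coord x| ≤ ∑ t ∈ Finset.range n, (A.rate t)⁻¹ := by
  induction n with
  | zero =>
    intro h hh x
    rw [BanditEnvironment.play, PMF.mem_support_pure_iff] at hh
    simp [hh, estimate]
  | succ n ih =>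
    intro h hh x
    obtain ⟨h', hh', z, _, r, hr, rfl⟩ := (env.mem_support_play_succ _).1 hh
    rw [estimate, Finset.sum_range_succ, env.length_of_mem_support_play _ hh']
    exact A.abs_update_le n (ih hh') z (env.bounded n z r hr) x

theorem boundedOn_estimate (n : ℕ) (x : X) :
    (env.play A.recommender n).BoundedOn fun h => A.estimate h ⬝ᵥ A.coord x :=
  ⟨_, fun _ hh => A.abs_estimate_le env hh x⟩

theorem boundedOn_potential (n : ℕ) {η : ℝ} (hη : 0 < η) :
    (env.play A.recommender n).BoundedOn fun h => A.potential η (A.estimate h) :=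
  ⟨_, fun _ hh => A.abs_potential_le hη (A.abs_estimate_le env hh)⟩

variable {g : ℕ → ι → ℝ} (hg : ∀ t (x : X), env.payoff t x = g t ⬝ᵥ A.coord x)

include hg

theorem pmfExpect_estimate (n : ℕ) (x : X) :
    (pmfExpect (env.play A.recommender n) fun h => A.estimate h ⬝ᵥ A.coord x) =
      ∑ t ∈ Finset.range n, env.payoff t x := by
  induction n with
  | zero => simp [BanditEnvironment.play, pmfExpect_pure, estimate]
  | succ n ih =>
    rw [env.pmfExpect_play_succ _ (A.boundedOn_estimate env (n + 1) x), Finset.sum_range_succ,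
      ← ih, ← pmfExpect_const (env.play A.recommender n) (env.payoff n x),
      ← pmfExpect_add (A.boundedOn_estimate env n x) (.const _)]
    refine pmfExpect_congr fun h hh => ?_
    have hl := env.length_of_mem_support_play _ hh
    simp only [estimate, recommender, hl]
    rw [A.pmfExpect_update n _ (env.bounded n) (fun z => (env.unbiased n z).trans (hg n z)), hg]

/-- The potential starts at zero and grows per round by at most the expected payoff plus the
one-round error; the power mean inequality absorbs each decrease of the rate. -/
theorem pmfExpect_potential_le (n : ℕ) :
    (pmfExpect (env.play A.recommender n) fun h => A.potential (A.rate n) (A.estimate h)) ≤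
      pmfExpect (env.play A.recommender n) env.cumPayoff +
        4 * A.dim ^ 2 * A.bound ^ 2 * ∑ t ∈ Finset.range n, A.rate t := by
  induction n with
  | zero =>
    simp [BanditEnvironment.play, pmfExpect_pure, estimate, potential,
      BanditEnvironment.cumPayoff, pmfExpect_const]
  | succ n ih =>
    have hb := A.boundedOn_potential env (n + 1) (A.rate_pos n)
    have hb0 := A.boundedOn_potential env n (A.rate_pos n)
    have hb1 : (env.play A.recommender n).BoundedOn fun h =>
        pmfExpect (A.recommender.recommend h) fun z => env.payoff n z :=
      .of_le A.bound fun h => abs_pmfExpect_le fun z _ => abs_feedback_mean_le env n z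
    calc (pmfExpect (env.play A.recommender (n + 1)) fun h =>
            A.potential (A.rate (n + 1)) (A.estimate h))
        ≤ pmfExpect (env.play A.recommender (n + 1)) fun h =>
            A.potential (A.rate n) (A.estimate h) :=
          pmfExpect_mono (A.boundedOn_potential env (n + 1) (A.rate_pos (n + 1))) hb fun h _ =>
            log_pmfExpect_exp_div_mono (A.bounded_dotProduct _ _) (A.rate_pos _)
              (A.rate_anti n.le_succ)
      _ ≤ pmfExpect (env.play A.recommender n) fun h => A.potential (A.rate n) (A.estimate h) +
            (pmfExpect (A.recommender.recommend h) fun z => env.payoff n z) +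
            4 * A.dim ^ 2 * A.bound ^ 2 * A.rate n := by
          rw [env.pmfExpect_play_succ _ hb]
          refine pmfExpect_mono (env.boundedOn_play_succ _ hb) ((hb0.add hb1).add (.const _))
            fun h hh => ?_
          have hl := env.length_of_mem_support_play _ hh
          simp only [estimate, recommender, hl, hg]
          exact A.pmfExpect_potential_update_le n _ (env.bounded n)
            fun z => (env.unbiased n z).trans (hg n z)
      _ ≤ _ := by
          rw [pmfExpect_add (hb0.add hb1) (.const _), pmfExpect_add hb0 hb1, pmfExpect_const,
            env.pmfExpect_cumPayoff_succ, Finset.sum_range_succ]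
          linarith

/-- Regret bound of the exponential weights recommender against an action in the support of the
prior. -/
theorem regret_le_of_mem_support (n : ℕ) {x : X} (hx : x ∈ A.prior.support) :
    ∑ t ∈ Finset.range n, env.payoff t x - pmfExpect (env.play A.recommender n) env.cumPayoff ≤
      -Real.log (A.prior x).toReal / A.rate n +
        4 * A.dim ^ 2 * A.bound ^ 2 * ∑ t ∈ Finset.range n, A.rate t := by
  have hη := A.rate_pos n
  -- The lower bound on the potential comes from the single atom `x`; in expectation the estimate at
  -- `x` is its true cumulative payoff.
  have h1 : (pmfExpect (env.play A.recommender n) fun h =>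
      A.estimate h ⬝ᵥ A.coord x + Real.log (A.prior x).toReal / A.rate n) ≤
      pmfExpect (env.play A.recommender n) fun h => A.potential (A.rate n) (A.estimate h) := by
    refine pmfExpect_mono ((A.boundedOn_estimate env n x).add (.const _))
      (A.boundedOn_potential env n hη) fun h _ => ?_
    rw [potential, le_div_iff₀ hη]
    have h2 := log_add_mul_le_log_pmfExpect_exp
      ((A.bounded_dotProduct A.prior (A.estimate h)).const_mul (A.rate n)) hx
    refine le_of_eq_of_le ?_ h2
    field_simp
  rw [pmfExpect_add (A.boundedOn_estimate env n x) (.const _), pmfExpect_const,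
    A.pmfExpect_estimate env hg] at h1
  have h3 := A.pmfExpect_potential_le env hg n
  rw [neg_div]
  linarith

end ExpWeights

end

/-! ### Multiscale net priors and barycentric spanners. -/

noncomputable section

open PMF Matrix

/-- The geometric distribution with `P(n) = 2⁻⁽ⁿ⁺¹⁾`. -/
def dyadicPMF : PMF ℕ :=
  ⟨fun n => 2⁻¹ ^ (n + 1), by
    have h : ∑' n : ℕ, (2⁻¹ : ENNReal) ^ (n + 1) = 1 := by
      simp_rw [pow_succ', ENNReal.tsum_mul_left, ENNReal.tsum_geometric, ENNReal.one_sub_inv_two,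
        inv_inv]
      exact ENNReal.inv_mul_cancel (by simp) (by simp)
    rw [← h]
    exact ENNReal.summable.hasSum⟩

theorem PMF.mul_le_bind_apply {α β : Type*} (p : PMF α) (f : α → PMF β) (a : α) (b : β) :
    p a * f a b ≤ p.bind f b := by
  rw [PMF.bind_apply]
  exact ENNReal.le_tsum a

theorem PMF.le_map_apply {α β : Type*} (p : PMF α) (f : α → β) (a : α) :
    p a ≤ p.map f (f a) := by
  refine le_trans ?_ (p.mul_le_bind_apply _ a (f a))
  simp

/-- A family of bounded vectors carries a prior that gives large mass to nets of all scales. -/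
theorem exists_net_prior {α ι : Type*} [Fintype ι] [Nonempty α] (a : α → ι → ℝ)
    (ha : ∀ x i, |a x i| ≤ 1) :
    ∃ π : PMF α, ∀ (k : ℕ) (x : α), ∃ x' ∈ π.support,
      -Real.log (π x').toReal ≤ ((k + 1) + Fintype.card ι * (k + 2)) * Real.log 2 ∧
      ∀ i, |a x i - a x' i| ≤ 1 / 2 ^ k := by
  classical
  -- The cube `[-1, 1]^ι` is cut into cells of side `2⁻ᵏ`; the endpoint `1` accounts for the extra
  -- index.
  have hlt : ∀ (k : ℕ) (x : α) (i : ι), ⌊(a x i + 1) * 2 ^ k⌋₊ < 2 ^ (k + 1) + 1 := by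
    intro k x i
    rw [Nat.lt_succ_iff]
    refine Nat.floor_le_of_le ?_
    have := (abs_le.1 (ha x i)).2
    push_cast
    rw [pow_succ']
    exact mul_le_mul_of_nonneg_right (by linarith) (by positivity)
  let cell : (k : ℕ) → α → ι → Fin (2 ^ (k + 1) + 1) := fun k x i => ⟨_, hlt k x i⟩
  -- One member of the family represents each occupied cell. Empty cells get an arbitrary member,
  -- which only wastes mass.
  let rep : (k : ℕ) → (ι → Fin (2 ^ (k + 1) + 1)) → α := fun k j =>
    if h : ∃ x, cell k x = j then h.choose else Classical.arbitrary α
  have hrep : ∀ k x, cell k (rep k (cell k x)) = cell k x := by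
    intro k x
    have h : ∃ y, cell k y = cell k x := ⟨x, rfl⟩
    simp only [rep, dif_pos h]
    exact h.choose_spec
  -- A geometrically distributed scale, then a uniform cell. One prior thus serves all horizons, and
  -- each representative at scale `k` has mass at least `2^(-(k+1)) (2^(k+1) + 1)^(-card ι)`.
  let π : PMF α := dyadicPMF.bind fun k => (PMF.uniformOfFintype _).map (rep k)
  refine ⟨π, fun k x => ?_⟩
  set x' := rep k (cell k x) with hx'
  have hmass : (2⁻¹ : ENNReal) ^ (k + 1) *
      ((Fintype.card (ι → Fin (2 ^ (k + 1) + 1)) : ℕ) : ENNReal)⁻¹ ≤ π x' := by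
    refine le_trans ?_ (PMF.mul_le_bind_apply _ _ k x')
    refine mul_le_mul' le_rfl ?_
    rw [← PMF.uniformOfFintype_apply (cell k x), hx']
    exact PMF.le_map_apply _ _ _
  have hreal : ((2 : ℝ) ^ ((k + 1) + Fintype.card ι * (k + 2)))⁻¹ ≤ (π x').toReal := by
    refine le_trans ?_ (ENNReal.toReal_mono (π.apply_ne_top x') hmass)
    rw [ENNReal.toReal_mul, ENNReal.toReal_pow, ENNReal.toReal_inv, ENNReal.toReal_inv,
      ENNReal.toReal_ofNat, ENNReal.toReal_natCast, inv_pow, ← mul_inv]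
    refine inv_anti₀ (by positivity) ?_
    rw [pow_add _ (k + 1) (Fintype.card ι * (k + 2)), Fintype.card_fun, Fintype.card_fin]
    refine mul_le_mul_of_nonneg_left ?_ (by positivity)
    push_cast
    rw [mul_comm (Fintype.card ι), pow_mul]
    refine pow_le_pow_left₀ (by positivity) ?_ _
    rw [pow_succ (2 : ℝ) (k + 1)]
    have : (1 : ℝ) ≤ 2 ^ (k + 1) := one_le_pow₀ one_le_two
    linarith
  have hpos : 0 < (π x').toReal := (inv_pos.2 (by positivity)).trans_le hreal
  refine ⟨x', fun h0 => ?_, ?_, fun i => ?_⟩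
  · rw [h0] at hpos
    simp at hpos
  · have := Real.log_le_log (by positivity) hreal
    rw [Real.log_inv, Real.log_pow] at this
    push_cast at this
    linarith
  · have h1 : ⌊(a x' i + 1) * 2 ^ k⌋₊ = ⌊(a x i + 1) * 2 ^ k⌋₊ :=
      congrArg Fin.val (congrFun (hrep k x) i)
    have hnn : ∀ y, 0 ≤ (a y i + 1) * 2 ^ k := fun y =>
      mul_nonneg (by linarith [(abs_le.1 (ha y i)).1]) (by positivity)
    have h2 := Nat.floor_le (hnn x)
    have h3 := Nat.lt_floor_add_one ((a x i + 1) * 2 ^ k)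
    have h4 := Nat.floor_le (hnn x')
    have h5 := Nat.lt_floor_add_one ((a x' i + 1) * 2 ^ k)
    rw [h1] at h4 h5
    rw [le_div_iff₀ (by positivity), ← abs_of_pos (show (0 : ℝ) < 2 ^ k by positivity), ← abs_mul,
      abs_le]
    constructor <;> linarith

/-- A compact set contains a barycentric spanner: finitely many of its points such that every
point of the set is a linear combination of them with coefficients in `[-1, 1]`. -/
theorem exists_barycentric_spanner {E : Type*} [NormedAddCommGroup E] [NormedSpace ℝ E]
    [FiniteDimensional ℝ E] {X : Set E} (hX : IsCompact X) :
    ∃ (d : ℕ) (b : Fin d → E) (coord : E → Fin d → ℝ), d ≤ Module.finrank ℝ E ∧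
      (∀ i, b i ∈ X) ∧ (∀ x ∈ X, ∀ i, |coord x i| ≤ 1) ∧
      (∀ x ∈ X, x = ∑ i, coord x i • b i) ∧ ∀ i, coord (b i) = Pi.single i 1 := by
  classical
  -- Inside its own span, `X` contains a basis, so the maximal determinant below is nonzero.
  set V := Submodule.span ℝ X with hV
  set d := Module.finrank ℝ V with hd
  obtain ⟨f, hfX, -, hfli⟩ := Submodule.exists_fun_fin_finrank_span_eq ℝ X
  let e : Module.Basis (Fin d) ℝ V := Module.finBasis ℝ V
  let X' : Set V := Subtype.val ⁻¹' X
  have hX' : IsCompact X' :=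
    (Submodule.closed_of_finiteDimensional V).isClosedEmbedding_subtypeVal.isCompact_preimage hX
  let f' : Fin d → V := fun i => ⟨f i, Submodule.subset_span (hfX i)⟩
  have hf'li : LinearIndependent ℝ f' := LinearIndependent.of_comp V.subtype hfli
  have hf'det : e.det f' ≠ 0 := by
    have := (e.is_basis_iff_det (v := f')).1
      ⟨hf'li, hf'li.span_eq_top_of_card_eq_finrank' (by simp [hd])⟩
    exact this.ne_zero
  have hcont : Continuous fun v : Fin d → V => |e.det v| := by
    simp only [Module.Basis.det_apply]
    refine Continuous.abs ?_
    refine Continuous.matrix_det (continuous_matrix fun i j => ?_)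
    exact (LinearMap.continuous_of_finiteDimensional (e.coord i)).comp (continuous_apply j)
  -- The spanner is a tuple of points of `X` with determinant of maximal absolute value.
  obtain ⟨v, hvX, hvmax⟩ := (isCompact_univ_pi fun _ : Fin d => hX').exists_isMaxOn
    ⟨f', fun i _ => hfX i⟩ hcont.continuousOn
  have hvX' : ∀ i, (v i : E) ∈ X := fun i => hvX i (Set.mem_univ i)
  have hvpos : 0 < |e.det v| :=
    (abs_pos.2 hf'det).trans_le (hvmax (fun i _ => hfX i : f' ∈ Set.univ.pi fun _ => X'))
  obtain ⟨hli, hsp⟩ := e.is_basis_iff_det.2 (isUnit_iff_ne_zero.2 (abs_pos.1 hvpos))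
  let c : Module.Basis (Fin d) ℝ V := Module.Basis.mk hli hsp.ge
  have hcv : ∀ i, c i = v i := fun i => Module.Basis.mk_apply hli hsp.ge i
  have hmem : ∀ x ∈ X, x ∈ V := fun x hx => Submodule.subset_span hx
  refine ⟨d, fun i => v i, fun x i => if h : x ∈ V then c.coord i ⟨x, h⟩ else 0,
    Submodule.finrank_le V, hvX', fun x hx i => ?_, fun x hx => ?_, fun i => ?_⟩
  · beta_reduce
    rw [dif_pos (hmem x hx)]
    -- Cramer's rule: the `i`-th coordinate of `x` is the ratio of determinants after replacing `v
    -- i` by `x`, so maximality bounds it by one.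
    have h1 := LinearMap.congr_fun (e.det_smul_mk_coord_eq_det_update hli hsp.ge i)
      ⟨x, hmem x hx⟩
    have h2 : e.det v * c.coord i ⟨x, hmem x hx⟩ =
        e.det (Function.update v i ⟨x, hmem x hx⟩) := h1
    have h3 : |e.det (Function.update v i ⟨x, hmem x hx⟩)| ≤ |e.det v| := by
      refine hvmax fun j _ => ?_
      by_cases hj : j = i
      · subst hj
        simpa [X'] using hx
      · simpa [hj, X'] using hvX' j
    rw [← h2, abs_mul] at h3
    exact le_of_mul_le_mul_left (by linarith) hvpos
  · have h1 := congrArg Subtype.val (c.sum_repr ⟨x, hmem x hx⟩)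
    simp only [hcv, Submodule.coe_sum, Submodule.coe_smul] at h1
    simp only [dif_pos (hmem x hx), Module.Basis.coord_apply]
    exact h1.symm
  · funext j
    beta_reduce
    rw [dif_pos (v i).2, Subtype.coe_eta, Module.Basis.coord_apply, ← hcv,
      Module.Basis.repr_self, Finsupp.single_eq_pi_single]

end

/-! ### Learning rates and the resulting numerical bounds. -/

noncomputable section

/-- The decay `√(log (t + 3) / (t + 3))` of anytime learning rates. -/
def rateDecay (t : ℕ) : ℝ := √(Real.log (t + 3) / (t + 3))

theorem rateDecay_pos (t : ℕ) : 0 < rateDecay t :=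
  Real.sqrt_pos.2 (div_pos (Real.log_pos (by linarith [t.cast_nonneg (α := ℝ)])) (by positivity))

/-- The function `log x / x` decreases only from `e` on, whence the shift by `3 > e`. -/
theorem rateDecay_antitone : Antitone rateDecay := by
  intro s t hst
  refine Real.sqrt_le_sqrt ?_
  have h3 := Real.exp_one_lt_three.le
  have hst' : (s : ℝ) ≤ t := Nat.cast_le.2 hst
  have hs := s.cast_nonneg (α := ℝ)
  exact Real.log_div_self_antitoneOn (show Real.exp 1 ≤ (s : ℝ) + 3 by linarith)
    (show Real.exp 1 ≤ (t : ℝ) + 3 by linarith) (by linarith)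

theorem log_add_three_le {T : ℕ} (hT : 2 ≤ T) : Real.log (T + 3) ≤ 3 * Real.log T := by
  have h : (2 : ℝ) ≤ T := by exact_mod_cast hT
  rw [show 3 * Real.log T = Real.log ((T : ℝ) ^ 3) by rw [Real.log_pow]; norm_num]
  exact Real.log_le_log (by positivity)
    (by nlinarith [mul_nonneg (sub_nonneg.2 h) (sub_nonneg.2 h)])

theorem log_pos_of_two_le {T : ℕ} (hT : 2 ≤ T) : 0 < Real.log T :=
  Real.log_pos (by exact_mod_cast hT)

theorem sum_inv_sqrt_le (T : ℕ) : ∑ t ∈ Finset.range T, (√((t : ℝ) + 3))⁻¹ ≤ 2 * √T := by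
  induction T with
  | zero => simp
  | succ n ih =>
    rw [Finset.sum_range_succ]
    -- A telescoping bound: `2 (a - b) a ≥ (a - b)(a + b) = 1` for `a = √(n + 1)` and `b = √n`.
    have h1 : (√((n : ℝ) + 3))⁻¹ ≤ 2 * √((n : ℝ) + 1) - 2 * √n := by
      have ha : 0 < √((n : ℝ) + 1) := Real.sqrt_pos.2 (by positivity)
      have hb : 0 ≤ √(n : ℝ) := Real.sqrt_nonneg _
      have hb' : √(n : ℝ) ≤ √((n : ℝ) + 1) := Real.sqrt_le_sqrt (by linarith)
      have hc : √((n : ℝ) + 1) ≤ √((n : ℝ) + 3) := Real.sqrt_le_sqrt (by linarith)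
      have ha2 := Real.sq_sqrt (show (0 : ℝ) ≤ n + 1 by positivity)
      have hb2 := Real.sq_sqrt (show (0 : ℝ) ≤ n by positivity)
      rw [inv_le_iff_one_le_mul₀ (by linarith)]
      have h2 : 1 ≤ (2 * √((n : ℝ) + 1) - 2 * √n) * √((n : ℝ) + 1) := by nlinarith
      refine h2.trans (mul_le_mul_of_nonneg_left hc (by linarith))
    push_cast
    linarith

theorem sum_rateDecay_le {T : ℕ} (hT : 2 ≤ T) :
    ∑ t ∈ Finset.range T, rateDecay t ≤ 4 * √(T * Real.log T) := by
  have hL := log_pos_of_two_le hT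
  have h1 : ∀ t ∈ Finset.range T, rateDecay t ≤ √(3 * Real.log T) * (√((t : ℝ) + 3))⁻¹ := by
    intro t ht
    have ht' : (t : ℝ) ≤ T := by exact_mod_cast (Finset.mem_range.1 ht).le
    have h2 := log_add_three_le hT
    have h3 : Real.log ((t : ℝ) + 3) ≤ Real.log (T + 3) :=
      Real.log_le_log (by positivity) (by linarith)
    rw [rateDecay, Real.sqrt_div' _ (by positivity), div_eq_mul_inv]
    exact mul_le_mul_of_nonneg_right (Real.sqrt_le_sqrt (h3.trans h2)) (by positivity)
  refine (Finset.sum_le_sum h1).trans ?_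
  rw [← Finset.mul_sum]
  refine (mul_le_mul_of_nonneg_left (sum_inv_sqrt_le T) (Real.sqrt_nonneg _)).trans ?_
  rw [Real.sqrt_mul (by norm_num), mul_comm (T : ℝ), Real.sqrt_mul hL.le]
  have h3 : √(3 : ℝ) ≤ 2 := Real.sqrt_le_iff.2 ⟨by norm_num, by norm_num⟩
  have h4 : 0 ≤ √(Real.log T) * √T := by positivity
  nlinarith

theorem log_mul_inv_rateDecay_le {T : ℕ} (hT : 2 ≤ T) :
    Real.log T * (rateDecay T)⁻¹ ≤ 2 * √(T * Real.log T) := by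
  have hL := log_pos_of_two_le hT
  have hT' : (2 : ℝ) ≤ T := by exact_mod_cast hT
  have h1 : Real.log T ≤ Real.log (T + 3) := Real.log_le_log (by linarith) (by linarith)
  have h2 : √(Real.log T / (4 * T)) ≤ rateDecay T := by
    refine Real.sqrt_le_sqrt ?_
    exact div_le_div₀ (hL.le.trans h1) h1 (by positivity) (by linarith)
  have h3 : 0 < √(Real.log T / (4 * T)) := Real.sqrt_pos.2 (by positivity)
  refine (mul_le_mul_of_nonneg_left (inv_anti₀ h3 h2) hL.le).trans (le_of_eq ?_)
  rw [← Real.sqrt_inv, inv_div]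
  have h4 : √(4 * T / Real.log T) = 2 * √(T * Real.log T) / Real.log T := by
    rw [Real.sqrt_eq_iff_mul_self_eq (by positivity) (by positivity)]
    have := Real.mul_self_sqrt (show 0 ≤ (T : ℝ) * Real.log T by positivity)
    field_simp
    nlinarith
  rw [h4]
  field_simp

/-- Anytime learning rates for dimension `m` and payoffs bounded by `B`. -/
def anytimeRate (m B : ℝ) (t : ℕ) : ℝ :=
  min (1 / (2 * m ^ 2 * B)) (rateDecay t / (B * √m))

theorem anytimeRate_pos {m B : ℝ} (hm : 0 < m) (hB : 0 < B) (t : ℕ) : 0 < anytimeRate m B t :=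
  lt_min (by positivity) (div_pos (rateDecay_pos t) (by positivity))

theorem anytimeRate_antitone {m B : ℝ} (hB : 0 < B) : Antitone (anytimeRate m B) := fun s t h =>
  min_le_min le_rfl (div_le_div_of_nonneg_right (rateDecay_antitone h) (by positivity))

theorem anytimeRate_mul_le {m B : ℝ} (hm : 0 < m) (hB : 0 < B) (t : ℕ) :
    anytimeRate m B t * m ^ 2 * B ≤ 1 / 2 := by
  have h := min_le_left (1 / (2 * m ^ 2 * B)) (rateDecay t / (B * √m))
  rw [le_div_iff₀ (by positivity)] at h
  rw [anytimeRate]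
  linarith

theorem inv_anytimeRate_le {m B : ℝ} (hm : 0 < m) (hB : 0 < B) (t : ℕ) :
    (anytimeRate m B t)⁻¹ ≤ 2 * m ^ 2 * B + B * √m * (rateDecay t)⁻¹ := by
  have h0 := rateDecay_pos t
  rcases min_choice (1 / (2 * m ^ 2 * B)) (rateDecay t / (B * √m)) with h | h
  · rw [anytimeRate, h, one_div, inv_inv]
    exact le_add_of_nonneg_right (by positivity)
  · rw [anytimeRate, h, inv_div, div_eq_mul_inv]
    exact le_add_of_nonneg_left (by positivity)

/-- The total regret of anytime exponential weights is of order `B m^(3/2) √(T log T)`. -/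
theorem anytimeRate_total_le {m B : ℝ} (hm : 1 ≤ m) (hB : 0 < B) {T : ℕ} (hT : 2 ≤ T)
    (hlarge : m ^ 3 * Real.log T ≤ T) :
    m * B + 8 * m * Real.log T * (anytimeRate m B T)⁻¹ +
      4 * m ^ 2 * B ^ 2 * ∑ t ∈ Finset.range T, anytimeRate m B t ≤
    50 * B * (m * √m) * √(T * Real.log T) := by
  have hm0 : 0 < m := by linarith
  have hL := log_pos_of_two_le hT
  have hT' : (2 : ℝ) ≤ T := by exact_mod_cast hT
  set S := √(T * Real.log T) with hS
  set L := Real.log T with hLdef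
  have hs : 0 < √m := Real.sqrt_pos.2 hm0
  have hss : √m * √m = m := Real.mul_self_sqrt hm0.le
  have hs1 : 1 ≤ √m := Real.one_le_sqrt.2 hm
  have hS1 : 1 ≤ S := by
    rw [hS, Real.one_le_sqrt]
    have h1 : Real.log 2 ≤ L := Real.log_le_log (by norm_num) hT'
    have h2 := Real.log_two_gt_d9
    nlinarith
  have h1 : m * B ≤ B * (m * √m) * S := by
    have h2 : m * B * 1 ≤ m * B * (√m * S) :=
      mul_le_mul_of_nonneg_left (one_le_mul_of_one_le_of_one_le hs1 hS1) (by positivity)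
    linarith
  -- The cost of capping the rate. After squaring, this is `m⁶ L² ≤ m³ T L`, which is where the long
  -- horizon enters.
  have h2 : m ^ 3 * L ≤ (m * √m) * S := by
    rw [← abs_of_nonneg (show 0 ≤ m ^ 3 * L by positivity),
      ← abs_of_nonneg (show 0 ≤ (m * √m) * S by positivity), ← sq_le_sq, mul_pow, mul_pow (m * √m),
      hS, Real.sq_sqrt (by positivity), mul_pow, sq √m, hss]
    have h3 := mul_le_mul_of_nonneg_left hlarge (show 0 ≤ m ^ 3 * L by positivity)
    linarith
  have h3 : 8 * m * L * (anytimeRate m B T)⁻¹ ≤ 32 * (B * (m * √m) * S) := by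
    have h4 := mul_le_mul_of_nonneg_left (inv_anytimeRate_le hm0 hB T)
      (show 0 ≤ 8 * m * L by positivity)
    have h5 := mul_le_mul_of_nonneg_left (log_mul_inv_rateDecay_le hT)
      (show 0 ≤ 8 * B * (m * √m) by positivity)
    have h6 := mul_le_mul_of_nonneg_left h2 (show 0 ≤ 16 * B by positivity)
    refine h4.trans ?_
    rw [← hS, ← hLdef] at h5
    linarith
  have h4 : 4 * m ^ 2 * B ^ 2 * ∑ t ∈ Finset.range T, anytimeRate m B t ≤
      16 * (B * (m * √m) * S) := by
    have h5 : ∑ t ∈ Finset.range T, anytimeRate m B t ≤ 4 * S / (B * √m) := by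
      refine (Finset.sum_le_sum fun t _ => min_le_right _ _).trans ?_
      rw [← Finset.sum_div]
      exact div_le_div_of_nonneg_right (sum_rateDecay_le hT) (by positivity)
    refine (mul_le_mul_of_nonneg_left h5 (by positivity)).trans (le_of_eq ?_)
    have h6 : m ^ 2 = (m * √m) * √m := by rw [mul_assoc, hss, sq]
    rw [h6]
    field_simp
    norm_num
  -- The three terms contribute `1 + 32 + 16 = 49`; nonnegativity allows rounding to `50`.
  have h5 : 0 ≤ B * (m * √m) * S := by positivity
  linarith

/-- For short horizons `T² ≤ m³ T log T`, so the trivial regret bound is already of the required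
order. -/
theorem mul_le_of_lt_cube_mul_log {m B : ℝ} (hm : 1 ≤ m) (hB : 0 ≤ B) {T : ℕ} (hT : 2 ≤ T)
    (hsmall : T < m ^ 3 * Real.log T) :
    2 * B * T ≤ 50 * B * (m * √m) * √(T * Real.log T) := by
  have hm0 : 0 < m := by linarith
  have hL := log_pos_of_two_le hT
  have h1 : (T : ℝ) ≤ (m * √m) * √(T * Real.log T) := by
    rw [← abs_of_nonneg (T.cast_nonneg (α := ℝ)),
      ← abs_of_nonneg (show 0 ≤ (m * √m) * √(|(T : ℝ)| * Real.log |(T : ℝ)|) by positivity),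
      ← sq_le_sq, mul_pow, mul_pow, abs_of_nonneg (T.cast_nonneg (α := ℝ)),
      Real.sq_sqrt hm0.le, Real.sq_sqrt (mul_nonneg T.cast_nonneg hL.le)]
    have h2 := mul_le_mul_of_nonneg_left hsmall.le (T.cast_nonneg (α := ℝ))
    linarith
  have h2 := mul_le_mul_of_nonneg_left h1 hB
  have h3 := mul_nonneg hB ((T.cast_nonneg (α := ℝ)).trans h1)
  linarith

theorem exists_scale {T : ℕ} (hT : 2 ≤ T) :
    ∃ k : ℕ, (T : ℝ) ≤ 2 ^ k ∧ ((k : ℝ) + 2) * Real.log 2 ≤ 4 * Real.log T := by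
  refine ⟨Nat.clog 2 T, by exact_mod_cast Nat.le_pow_clog one_lt_two T, ?_⟩
  have h1 := Nat.pow_pred_clog_lt_self one_lt_two (show 1 < T by omega)
  have h2 : 0 < Nat.clog 2 T := Nat.clog_pos one_lt_two hT
  obtain ⟨j, hj⟩ : ∃ j, Nat.clog 2 T = j + 1 := ⟨_, (Nat.succ_pred_eq_of_pos h2).symm⟩
  rw [hj] at h1 ⊢
  have h3 : (2 : ℝ) ^ j ≤ T := by exact_mod_cast h1.le
  have hT' : (2 : ℝ) ≤ T := by exact_mod_cast hT
  -- Here `k = j + 1` with `2^j ≤ T`, and `8 ≤ T³` pays for the remaining factor.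
  have h4 : (2 : ℝ) ^ (j + 3) ≤ (T : ℝ) ^ 4 := by
    rw [pow_add, pow_succ' (T : ℝ) 3, mul_comm, mul_comm (T : ℝ)]
    exact mul_le_mul (pow_le_pow_left₀ (by norm_num) hT' 3) h3 (by positivity) (by positivity)
  have h5 := Real.log_le_log (by positivity) h4
  rw [Real.log_pow, Real.log_pow] at h5
  push_cast at h5 ⊢
  linarith

end

/-! ### The regret minimizer on a compact set. -/

noncomputable section

open PMF Matrix

/-- Spanner points have unit vectors as coordinates, so the uniform distribution on them has second
moment matrix `1/d` times the identity. -/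
theorem exists_exploration {α : Type*} [Nonempty α] {d : ℕ} (b : Fin d → α)
    (coord : α → Fin d → ℝ) (hcoord : ∀ x i, |coord x i| ≤ 1)
    (hb : ∀ i, coord (b i) = Pi.single i 1) :
    ∃ ν : PMF α, ∀ w : Fin d → ℝ, w ⬝ᵥ w = d * pmfExpect ν fun x => (w ⬝ᵥ coord x) ^ 2 := by
  rcases Nat.eq_zero_or_pos d with rfl | hd
  · exact ⟨PMF.pure (Classical.arbitrary α), fun w => by simp [dotProduct]⟩
  · have : Nonempty (Fin d) := ⟨⟨0, hd⟩⟩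
    refine ⟨(PMF.uniformOfFintype (Fin d)).map b, fun w => ?_⟩
    rw [pmfExpect_map ((BoundedOn.dotProduct hcoord w).pow 2), pmfExpect_fintype]
    have hd0 : (d : ℝ) ≠ 0 := by exact_mod_cast hd.ne'
    simp only [hb, dotProduct_single, mul_one, PMF.uniformOfFintype_apply, Fintype.card_fin,
      ENNReal.toReal_inv, ENNReal.toReal_natCast, ← Finset.mul_sum]
    rw [mul_inv_cancel_left₀ hd0]
    exact Finset.sum_congr rfl fun i _ => (sq (w i)).symm

namespace ExpWeights

variable {E : Type*} [AddCommGroup E] [Module ℝ E] {X : Set E} {d : ℕ} (A : ExpWeights X (Fin d))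

/-- Regret bound of the anytime exponential weights recommender whose prior gives large mass to
nets of all scales. -/
theorem regret_le_of_net (env : BanditEnvironment X A.bound)
    (hrate : A.rate = anytimeRate A.dim A.bound)
    (hprior : ∀ (k : ℕ) (x : X), ∃ x' ∈ A.prior.support,
      -Real.log (A.prior x').toReal ≤ ((k + 1) + Fintype.card (Fin d) * (k + 2)) * Real.log 2 ∧
      ∀ i, |A.coord x i - A.coord x' i| ≤ 1 / 2 ^ k)
    {g : ℕ → Fin d → ℝ} (hg : ∀ t (x : X), env.payoff t x = g t ⬝ᵥ A.coord x)
    (hgB : ∀ t i, |g t i| ≤ A.bound) {T : ℕ} (hT : 2 ≤ T) (x : X) :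
    ∑ t ∈ Finset.range T, env.payoff t x - pmfExpect (env.play A.recommender T) env.cumPayoff ≤
      50 * A.bound * (A.dim * √A.dim) * √(T * Real.log T) := by
  have hB := A.bound_pos
  have hm := A.one_le_dim
  rcases lt_or_ge (T : ℝ) (A.dim ^ 3 * Real.log T) with hsmall | hlarge
  · exact (env.regret_le_two_mul _ T x).trans (mul_le_of_lt_cube_mul_log hm hB.le hT hsmall)
  obtain ⟨k, hk1, hk2⟩ := exists_scale hT
  obtain ⟨x', hx', hmass, hclose⟩ := hprior k x
  have h1 := A.regret_le_of_mem_support env hg T hx'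
  have hd : (d : ℝ) ≤ A.dim := by simpa using A.card_le_dim
  have hTpos : (0 : ℝ) < T := by exact_mod_cast (by omega : 0 < T)
  -- At resolution `1/T`, replacing the comparator by a net point costs `dim * bound` over all
  -- rounds.
  have h2 : ∀ t ∈ Finset.range T, env.payoff t x ≤ env.payoff t x' + A.dim * A.bound / T := by
    intro t _
    rw [hg, hg, ← sub_le_iff_le_add', ← dotProduct_sub]
    calc g t ⬝ᵥ (A.coord x - A.coord x')
        ≤ ∑ _i : Fin d, A.bound * (1 / T) := by
          refine Finset.sum_le_sum fun i _ => (le_abs_self _).trans ?_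
          rw [abs_mul]
          refine mul_le_mul (hgB t i) ((hclose i).trans ?_) (abs_nonneg _) hB.le
          exact one_div_le_one_div_of_le hTpos hk1
      _ = d * A.bound / T := by
          rw [Finset.sum_const, Finset.card_univ, Fintype.card_fin, nsmul_eq_mul]
          ring
      _ ≤ _ := by gcongr
  have h3 := Finset.sum_le_sum h2
  rw [Finset.sum_add_distrib, Finset.sum_const, Finset.card_range, nsmul_eq_mul,
    mul_div_cancel₀ _ hTpos.ne'] at h3
  have h4 : -Real.log (A.prior x').toReal ≤ 8 * A.dim * Real.log T := by
    refine hmass.trans ?_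
    have hl2 : 0 ≤ Real.log 2 := Real.log_nonneg one_le_two
    have hk0 : (0 : ℝ) ≤ k := k.cast_nonneg
    have h5 : ((k : ℝ) + 1) + Fintype.card (Fin d) * (k + 2) ≤ 2 * A.dim * (k + 2) := by
      rw [Fintype.card_fin]
      nlinarith
    have h6 := mul_le_mul_of_nonneg_right h5 hl2
    have h7 := mul_le_mul_of_nonneg_left hk2 (show 0 ≤ 2 * A.dim by linarith)
    linarith
  have h5 := mul_le_mul_of_nonneg_right h4 (inv_pos.2 (A.rate_pos T)).le
  have h6 := anytimeRate_total_le hm hB hT hlarge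
  rw [← hrate] at h6
  rw [div_eq_mul_inv] at h1
  linarith

end ExpWeights

/-- A compact set in a space of dimension at most `m` has a regret minimizer for bandit feedback
with regret of order `B m^(3/2) √(T log T)`. -/
theorem exists_isRegretMinimizer {E : Type*} [NormedAddCommGroup E] [NormedSpace ℝ E]
    [FiniteDimensional ℝ E] {X : Set E} (hX : IsCompact X) (hne : X.Nonempty) {m B : ℝ}
    (hm : 1 ≤ m) (hdim : Module.finrank ℝ E ≤ m) (hB : 0 ≤ B) :
    ∃ R : Recommender X,
      R.IsRegretMinimizer B fun T => 50 * B * (m * √m) * √(T * Real.log T) := by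
  have hne' : Nonempty X := hne.to_subtype
  -- For `B = 0` the learning rates are not defined meaningfully, but all payoffs on `X` vanish and
  -- any recommender works.
  rcases hB.eq_or_lt with rfl | hB
  · refine ⟨⟨fun _ => PMF.pure (Classical.arbitrary X)⟩, fun env T _ x hx => ?_⟩
    simpa using env.regret_le_two_mul _ T ⟨x, hx⟩
  obtain ⟨d, b, coord, hd, hbX, hcoord, hrepr, hb⟩ := exists_barycentric_spanner hX
  have hdm : (d : ℝ) ≤ m := (Nat.cast_le.2 hd).trans hdim
  have hm0 : 0 < m := by linarith
  have hcoord' : ∀ (x : X) i, |coord x i| ≤ 1 := fun x => hcoord x x.2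
  obtain ⟨ν, hν⟩ := exists_exploration (fun i => (⟨b i, hbX i⟩ : X)) (fun x => coord x) hcoord' hb
  obtain ⟨π, hπ⟩ := exists_net_prior (fun x : X => coord x) hcoord'
  let A : ExpWeights X (Fin d) :=
    { coord := fun x => coord x
      abs_coord_le := hcoord'
      prior := π
      explore := ν
      dim := m
      one_le_dim := hm
      card_le_dim := by simpa using hdm
      coercive := fun w => (hν w).le.trans
        (mul_le_mul_of_nonneg_right hdm (pmfExpect_nonneg fun x => sq_nonneg _))
      bound := B
      bound_pos := hB
      rate := anytimeRate m B
      rate_pos := anytimeRate_pos hm0 hB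
      rate_anti := anytimeRate_antitone hB
      rate_le := anytimeRate_mul_le hm0 hB }
  refine ⟨A.recommender, fun env T hT x hx => ?_⟩
  -- In spanner coordinates the payoff vector lists the payoffs of the spanner points; these lie in
  -- `X`, so its entries are bounded by `B`.
  refine A.regret_le_of_net env rfl hπ (g := fun t i => env.payoff t (b i)) (fun t z => ?_)
    (fun t i => abs_feedback_mean_le env t ⟨b i, hbX i⟩) hT ⟨x, hx⟩
  conv_lhs => rw [hrepr z z.2, map_sum]
  simp only [map_smul, smul_eq_mul, dotProduct]
  exact Finset.sum_congr rfl fun i _ => mul_comm _ _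

end

/-! ### Geometry of the persuasive schemes. -/

noncomputable section

namespace PersuasionProblem

variable {C Y : Type*} [Fintype C] [Fintype Y] (I : PersuasionProblem C Y)

/-- The polytope of conditional response distributions that satisfy the linear persuasiveness
constraints. -/
def persuasivePolytope : Set (C → Y → ℝ) :=
  {w | (∀ c, w c ∈ stdSimplex ℝ Y) ∧
    ∀ y y', ∑ c, (I.prior c).toReal * w c y * I.u c y' ≤ ∑ c, (I.prior c).toReal * w c y * I.u c y}

theorem toReal_mem_stdSimplex (p : PMF Y) : (fun y => (p y).toReal) ∈ stdSimplex ℝ Y :=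
  ⟨fun _ => ENNReal.toReal_nonneg, by simpa [tsum_fintype] using p.tsum_toReal⟩

theorem exists_pmf_toReal_eq {w : Y → ℝ} (hw : w ∈ stdSimplex ℝ Y) :
    ∃ p : PMF Y, (fun y => (p y).toReal) = w := by
  refine ⟨PMF.ofFintype (fun y => ENNReal.ofReal (w y)) ?_, ?_⟩
  · rw [← ENNReal.ofReal_sum_of_nonneg fun y _ => hw.1 y, hw.2, ENNReal.ofReal_one]
  · funext y
    rw [PMF.ofFintype_apply, ENNReal.toReal_ofReal (hw.1 y)]

/-- Multiplying by the signal probability makes the constraints linear. For signals that are never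
sent, every summand vanishes and the linear constraint is void. -/
theorem mem_persuasiveSchemes_iff (φ : DirectScheme C Y) :
    φ ∈ I.persuasiveSchemes ↔ (fun c y => (φ c y).toReal) ∈ I.persuasivePolytope := by
  have hpost : ∀ y y', ∑ c, I.posterior φ y c * I.u c y' =
      (∑ c, (I.prior c).toReal * (φ c y).toReal * I.u c y') / I.signalProb φ y := fun y y' => by
    rw [Finset.sum_div]
    exact Finset.sum_congr rfl fun c _ => by rw [posterior]; ring
  constructor
  · refine fun h => ⟨fun c => toReal_mem_stdSimplex _, fun y y' => ?_⟩
    rcases (show 0 ≤ I.signalProb φ y from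
      Finset.sum_nonneg fun c _ => by positivity).eq_or_lt with h0 | hpos
    · have hz : ∀ c, (I.prior c).toReal * (φ c y).toReal = 0 := fun c =>
        (Finset.sum_eq_zero_iff_of_nonneg fun c _ => by positivity).1 h0.symm c (Finset.mem_univ c)
      simp [hz]
    · have := h y hpos y'
      rwa [hpost, hpost, div_le_div_iff_of_pos_right hpos] at this
  · rintro ⟨_, h⟩ y hpos y'
    rw [hpost, hpost, div_le_div_iff_of_pos_right hpos]
    exact h y y'

theorem image_persuasiveSchemes :
    (fun (φ : DirectScheme C Y) c y => (φ c y).toReal) '' I.persuasiveSchemes =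
      I.persuasivePolytope := by
  ext w
  constructor
  · rintro ⟨φ, hφ, rfl⟩
    exact (I.mem_persuasiveSchemes_iff φ).1 hφ
  · intro hw
    choose φ hφ using fun c => exists_pmf_toReal_eq (hw.1 c)
    have h : (fun c y => (φ c y).toReal) = w := funext hφ
    exact ⟨φ, (I.mem_persuasiveSchemes_iff φ).2 (h ▸ hw), h⟩

theorem isCompact_persuasivePolytope : IsCompact I.persuasivePolytope := by
  have h1 : IsCompact (Set.univ.pi fun _ : C => stdSimplex ℝ Y) :=
    isCompact_univ_pi fun _ => isCompact_stdSimplex ℝ Y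
  refine h1.of_isClosed_subset ?_ fun w hw c _ => hw.1 c
  have h2 : I.persuasivePolytope = (Set.univ.pi fun _ : C => stdSimplex ℝ Y) ∩
      ⋂ (y) (y'), {w | ∑ c, (I.prior c).toReal * w c y * I.u c y' ≤
        ∑ c, (I.prior c).toReal * w c y * I.u c y} := by
    ext w
    simp [persuasivePolytope]
  rw [h2]
  exact h1.isClosed.inter <| isClosed_iInter fun y => isClosed_iInter fun y' =>
    isClosed_le (by fun_prop) (by fun_prop)

theorem convex_persuasivePolytope : Convex ℝ I.persuasivePolytope := by
  intro w hw w' hw' a b ha hb hab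
  refine ⟨fun c => convex_stdSimplex ℝ Y (hw.1 c) (hw'.1 c) ha hb hab, fun y y' => ?_⟩
  have h : ∀ z, ∑ c, (I.prior c).toReal * (a • w + b • w') c y * I.u c z =
      a * (∑ c, (I.prior c).toReal * w c y * I.u c z) +
        b * ∑ c, (I.prior c).toReal * w' c y * I.u c z := fun z => by
    rw [Finset.mul_sum, Finset.mul_sum, ← Finset.sum_add_distrib]
    refine Finset.sum_congr rfl fun c _ => ?_
    simp only [Pi.add_apply, Pi.smul_apply, smul_eq_mul]
    ring
  rw [h, h]
  exact add_le_add (mul_le_mul_of_nonneg_left (hw.2 y y') ha)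
    (mul_le_mul_of_nonneg_left (hw'.2 y y') hb)

theorem persuasiveSchemes_nonempty [Nonempty Y] : I.persuasiveSchemes.Nonempty := by
  classical
  -- Always recommending a response that is optimal under the prior reveals nothing and is
  -- persuasive.
  obtain ⟨y₀, hy₀⟩ := Finite.exists_max fun y => ∑ c, (I.prior c).toReal * I.u c y
  refine ⟨fun _ => PMF.pure y₀, (I.mem_persuasiveSchemes_iff _).2
    ⟨fun c => toReal_mem_stdSimplex _, fun y y' => ?_⟩⟩
  by_cases h : y = y₀
  · subst h
    simpa using hy₀ y'
  · simp [PMF.pure_apply_of_ne _ _ h]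

theorem image_embed : I.embed '' I.persuasiveSchemes = I.embedLinear '' I.persuasivePolytope := by
  rw [← image_persuasiveSchemes, Set.image_image]
  rfl

theorem isCompact_image_embed : IsCompact (I.embed '' I.persuasiveSchemes) := by
  rw [image_embed]
  exact I.isCompact_persuasivePolytope.image (LinearMap.continuous_of_finiteDimensional _)

theorem hull_eq : I.hull = I.embed '' I.persuasiveSchemes := by
  rw [hull, image_embed]
  exact (I.convex_persuasivePolytope.linear_image I.embedLinear).convexHull_eq

theorem isCompact_hull : IsCompact I.hull := I.hull_eq ▸ I.isCompact_image_embed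

theorem hull_nonempty [Nonempty Y] : I.hull.Nonempty :=
  I.hull_eq ▸ I.persuasiveSchemes_nonempty.image _

theorem nonempty_decomposition : Nonempty I.Decomposition := by
  have h : ∀ z : I.hull, ∃ φ : I.persuasiveSchemes, I.embed φ = z := fun z => by
    obtain ⟨φ, hφ, h⟩ : (z : Y → ℝ) ∈ I.embed '' I.persuasiveSchemes := by
      rw [← hull_eq]
      exact z.2
    exact ⟨⟨φ, hφ⟩, h⟩
  choose φ hφ using h
  -- By `hull_eq` every point of the hull is the image of a single scheme, which is repeated at all
  -- indices; Carathéodory's theorem is not needed.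
  refine ⟨⟨fun z _ => φ z, fun _ => PMF.pure 0, fun z => ?_⟩⟩
  rw [← Finset.sum_smul, (toReal_mem_stdSimplex _).2, one_smul, hφ]

/-- The negated sum of coordinates, which recovers the Advisor's utility from `f`. -/
def utilityFunctional (Y : Type*) [Fintype Y] : (Y → ℝ) →ₗ[ℝ] ℝ :=
  -∑ y, LinearMap.proj y

theorem utilityFunctional_embed (φ : DirectScheme C Y) :
    utilityFunctional Y (I.embed φ) = I.advisorUtility φ := by
  simp only [utilityFunctional, embed, embedLinear, advisorUtility, LinearMap.neg_apply,
    LinearMap.sum_apply, LinearMap.proj_apply, LinearMap.coe_mk, AddHom.coe_mk,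
    Finset.sum_neg_distrib, neg_neg]
  exact Finset.sum_comm

theorem exists_isMaxOn_advisorUtility [Nonempty Y] :
    ∃ φ ∈ I.persuasiveSchemes, IsMaxOn I.advisorUtility I.persuasiveSchemes φ := by
  obtain ⟨z, ⟨φ, hφ, rfl⟩, hz⟩ := I.isCompact_image_embed.exists_isMaxOn
    (I.persuasiveSchemes_nonempty.image _)
    (LinearMap.continuous_of_finiteDimensional (utilityFunctional Y)).continuousOn
  refine ⟨φ, hφ, fun ψ hψ => ?_⟩
  have := hz (Set.mem_image_of_mem _ hψ)
  simpa only [Set.mem_ofPred_eq, utilityFunctional_embed] using this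

end PersuasionProblem

end

/-! ### Reduction of the persuasion algorithm to the bandit problem. -/

noncomputable section

namespace PersuasionProblem

open PMF

variable {C Y : Type*} (I : PersuasionProblem C Y)

/-- The law of the realized utility when the scheme `φ` is used. -/
def realizedUtility (φ : DirectScheme C Y) : PMF ℝ :=
  I.prior.bind fun c => (φ c).bind fun y => PMF.pure (I.v c y)

variable {I}

theorem abs_le_of_mem_support_realizedUtility {B : ℝ} (hv : ∀ c y, |I.v c y| ≤ B)
    {φ : DirectScheme C Y} {r : ℝ}
    (hr : r ∈ (I.realizedUtility φ).support) : |r| ≤ B := by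
  simp only [realizedUtility, PMF.mem_support_bind_iff, PMF.mem_support_pure_iff] at hr
  obtain ⟨c, _, y, _, rfl⟩ := hr
  exact hv c y

variable [Fintype C] [Fintype Y]

theorem pmfExpect_weight_advisorUtility (D : I.Decomposition) (z : I.hull) :
    (pmfExpect (D.weight z) fun i => I.advisorUtility (D.scheme z i)) =
      utilityFunctional Y (z : Y → ℝ) := by
  rw [pmfExpect_fintype]
  conv_rhs => rw [← D.combine z, map_sum]
  simp only [map_smul, smul_eq_mul, utilityFunctional_embed]

variable {B : ℝ} (hv : ∀ c y, |I.v c y| ≤ B)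

include hv

theorem pmfExpect_realizedUtility (φ : DirectScheme C Y) :
    pmfExpect (I.realizedUtility φ) id = I.advisorUtility φ := by
  have h : (I.realizedUtility φ).BoundedOn id :=
    ⟨B, fun r hr => abs_le_of_mem_support_realizedUtility hv hr⟩
  rw [realizedUtility] at h ⊢
  rw [pmfExpect_bind h, pmfExpect_fintype, advisorUtility]
  refine Finset.sum_congr rfl fun c _ => ?_
  have hb : ((φ c).bind fun y => PMF.pure (I.v c y)).BoundedOn id := by
    refine ⟨B, fun r hr => ?_⟩
    simp only [PMF.mem_support_bind_iff, PMF.mem_support_pure_iff] at hr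
    obtain ⟨y, _, rfl⟩ := hr
    exact hv c y
  rw [pmfExpect_bind hb, pmfExpect_fintype, Finset.mul_sum]
  simp only [pmfExpect_pure, id_eq, mul_assoc]

theorem abs_advisorUtility_le (φ : DirectScheme C Y) : |I.advisorUtility φ| ≤ B := by
  rw [← pmfExpect_realizedUtility hv]
  exact abs_pmfExpect_le fun r hr => abs_le_of_mem_support_realizedUtility hv hr

/-- The bandit environment that the persuasion algorithm presents to its regret minimizer. -/
def environment (D : I.Decomposition) : BanditEnvironment I.hull B where
  payoff _ := utilityFunctional Y
  feedback _ z := (D.weight z).bind fun i => I.realizedUtility (D.scheme z i)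
  bounded t z r hr := by
    obtain ⟨i, _, hi⟩ := (PMF.mem_support_bind_iff _ _ _).1 hr
    exact abs_le_of_mem_support_realizedUtility hv hi
  unbiased t z := by
    rw [pmfExpect_bind, pmfExpect_fintype]
    · simp only [pmfExpect_realizedUtility hv, ← utilityFunctional_embed]
      rw [← pmfExpect_weight_advisorUtility D z, pmfExpect_fintype]
      simp only [utilityFunctional_embed]
    · refine ⟨B, fun r hr => ?_⟩
      obtain ⟨i, _, hi⟩ := (PMF.mem_support_bind_iff _ _ _).1 hr
      exact abs_le_of_mem_support_realizedUtility hv hi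

variable (R : Recommender I.hull) (D : I.Decomposition)

/-- The recommender sees schemes, items and responses only through the realized utility, so
integrating them out round by round leaves bandit play with the mixed feedback law. -/
theorem map_observed_run (n : ℕ) :
    (I.run R D n).map I.observed = (environment hv D).play R n := by
  induction n with
  | zero => simp [run, BanditEnvironment.play, PMF.pure_map, observed]
  | succ n ih =>
    rw [run, BanditEnvironment.play, ← ih, PMF.bind_map, PMF.map_bind]
    congr 1
    funext h
    rw [Function.comp_apply, PMF.map_bind]
    congr 1
    funext z
    simp only [environment, realizedUtility, PMF.map_bind, PMF.bind_bind, PMF.pure_bind,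
      PMF.pure_map]
    rfl

theorem length_of_mem_support_run {n : ℕ} {h : List I.Round} (hh : h ∈ (I.run R D n).support) :
    h.length = n := by
  have h1 : I.observed h ∈ ((environment hv D).play R n).support := by
    rw [← map_observed_run]
    exact (PMF.mem_support_map_iff _ _ _).2 ⟨h, hh, rfl⟩
  simpa [observed] using (environment hv D).length_of_mem_support_play R h1

theorem boundedOn_sum_advisorUtility (n : ℕ) :
    (I.run R D n).BoundedOn fun h => (h.map fun r => I.advisorUtility r.scheme).sum := by
  refine ⟨n * B, fun h hh => ?_⟩
  beta_reduce
  rw [← length_of_mem_support_run hv R D hh]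
  clear hh
  induction h with
  | nil => simp
  | cons r h ih =>
    rw [List.map_cons, List.sum_cons, List.length_cons, Nat.cast_add_one]
    refine (abs_add_le _ _).trans ?_
    linarith [abs_advisorUtility_le hv r.scheme]

/-- The total expected utility of the sampled schemes is the total expected payoff of the regret
minimizer. -/
theorem pmfExpect_run_sum_advisorUtility (n : ℕ) :
    (pmfExpect (I.run R D n) fun h => (h.map fun r => I.advisorUtility r.scheme).sum) =
      pmfExpect ((environment hv D).play R n) (environment hv D).cumPayoff := by
  induction n with
  | zero => simp [run, BanditEnvironment.play, pmfExpect_pure, BanditEnvironment.cumPayoff]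
  | succ n ih =>
    have hpay : ∀ z : I.hull, |utilityFunctional Y (z : Y → ℝ)| ≤ B :=
      abs_feedback_mean_le (environment hv D) n
    have hb := boundedOn_sum_advisorUtility hv R D (n + 1)
    rw [BanditEnvironment.pmfExpect_cumPayoff_succ, ← ih, ← map_observed_run,
      pmfExpect_map (.of_le B fun h => abs_pmfExpect_le fun z _ =>
        abs_feedback_mean_le (environment hv D) n z),
      ← pmfExpect_add (boundedOn_sum_advisorUtility hv R D n)
        (.of_le B fun h => abs_pmfExpect_le fun z _ =>
          abs_feedback_mean_le (environment hv D) n z)]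
    rw [run] at hb ⊢
    rw [pmfExpect_bind hb]
    refine pmfExpect_congr fun h hh => ?_
    have hb1 := hb.of_bind hh
    have hinner : ∀ z ∈ (R.recommend (I.observed h)).support,
        (pmfExpect ((D.weight z).bind fun i => I.prior.bind fun c =>
          ((D.scheme z i : DirectScheme C Y) c).bind fun y =>
            PMF.pure (⟨z, D.scheme z i, c, y⟩ :: h)) fun h =>
              (h.map fun r => I.advisorUtility r.scheme).sum) =
        (h.map fun r => I.advisorUtility r.scheme).sum + utilityFunctional Y (z : Y → ℝ) := by
      intro z hz
      have hb2 := hb1.of_bind hz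
      rw [pmfExpect_bind hb2, ← pmfExpect_weight_advisorUtility D z]
      conv_rhs => rw [← pmfExpect_const (D.weight z) (List.sum _)]
      rw [← pmfExpect_add (.const _) (.of_le B fun i => abs_advisorUtility_le hv _)]
      refine pmfExpect_congr fun i hi => ?_
      have hb3 := hb2.of_bind hi
      rw [pmfExpect_bind hb3]
      -- Regret counts `v(φₜ)` rather than the realized utility, so item and response drop out once
      -- the index is fixed.
      refine Eq.trans (pmfExpect_congr fun c hc => ?_) (pmfExpect_const _ _)
      rw [pmfExpect_bind (hb3.of_bind hc)]
      simp only [pmfExpect_pure, List.map_cons, List.sum_cons, pmfExpect_const]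
      exact add_comm _ _
    rw [pmfExpect_bind hb1, pmfExpect_congr hinner,
      pmfExpect_add (.const _) (.of_le B hpay), pmfExpect_const]
    rfl

theorem expectedRegret_le {ρ : ℕ → ℝ} (hR : R.IsRegretMinimizer B ρ) {φ : DirectScheme C Y}
    (hφ : φ ∈ I.persuasiveSchemes) (hmax : IsMaxOn I.advisorUtility I.persuasiveSchemes φ)
    {T : ℕ} (hT : 2 ≤ T) : I.expectedRegret R D T ≤ ρ T := by
  have hsup : sSup ((fun φ => ∑ _t ∈ Finset.range T, I.advisorUtility φ) '' I.persuasiveSchemes) =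
      ∑ _t ∈ Finset.range T, I.advisorUtility φ := by
    refine IsGreatest.csSup_eq ⟨Set.mem_image_of_mem _ hφ, ?_⟩
    rintro _ ⟨ψ, hψ, rfl⟩
    exact Finset.sum_le_sum fun _ _ => hmax hψ
  have h1 := hR (environment hv D) T hT (I.embed φ)
    (subset_convexHull ℝ _ (Set.mem_image_of_mem _ hφ))
  have h2 : I.expectedRegret R D T = ∑ _t ∈ Finset.range T, I.advisorUtility φ -
      pmfExpect ((environment hv D).play R T) (environment hv D).cumPayoff := by
    have h3 : I.regret T = fun h => ∑ _t ∈ Finset.range T, I.advisorUtility φ -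
        (h.map fun r => I.advisorUtility r.scheme).sum := funext fun h => by rw [regret, hsup]
    rw [expectedRegret, ← pmfExpect_run_sum_advisorUtility, h3,
      pmfExpect_sub (.const _) (boundedOn_sum_advisorUtility hv R D T), pmfExpect_const]
  rw [h2]
  refine le_of_eq_of_le ?_ h1
  simp only [environment, utilityFunctional_embed]

end PersuasionProblem

theorem rpow_three_halves {x : ℝ} (hx : 0 < x) : x ^ (3 / 2 : ℝ) = x * √x := by
  rw [show (3 / 2 : ℝ) = 1 + 1 / 2 by norm_num, Real.rpow_add hx, Real.rpow_one,
    ← Real.sqrt_eq_rpow]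

end

/-! ### The main theorem. -/

theorem theorem1 :
    ∃ K : ℝ, 0 < K ∧
      ∀ (C Y : Type*) [Fintype C] [Fintype Y] [Nonempty Y] (I : PersuasionProblem C Y) (B : ℝ),
        (∀ c y, |I.v c y| ≤ B) →
        (∃ φ ∈ I.persuasiveSchemes, IsMaxOn I.advisorUtility I.persuasiveSchemes φ) ∧
        Nonempty I.Decomposition ∧
        ∃ R : Recommender I.hull,
          R.IsRegretMinimizer B (fun T : ℕ =>
            K * B * (Fintype.card Y : ℝ) ^ (3 / 2 : ℝ) * Real.sqrt (T * Real.log T)) ∧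
          ∀ (D : I.Decomposition) (T : ℕ), 2 ≤ T →
            I.expectedRegret R D T ≤
              K * B * (Fintype.card Y : ℝ) ^ (3 / 2 : ℝ) * Real.sqrt (T * Real.log T) := by
  refine ⟨50, by norm_num, fun C Y _ _ _ I B hv => ?_⟩
  obtain ⟨φ, hφ, hmax⟩ := I.exists_isMaxOn_advisorUtility
  have hB : 0 ≤ B := by
    obtain ⟨c, _⟩ := I.prior.support_nonempty
    exact (abs_nonneg _).trans (hv c (Classical.arbitrary Y))
  have hm : (1 : ℝ) ≤ Fintype.card Y := by exact_mod_cast Fintype.card_pos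
  obtain ⟨R, hR⟩ := exists_isRegretMinimizer I.isCompact_hull I.hull_nonempty hm
    (by rw [Module.finrank_fintype_fun_eq_card]) hB
  rw [← rpow_three_halves (by linarith)] at hR
  exact ⟨⟨φ, hφ, hmax⟩, I.nonempty_decomposition, R, hR, fun D T hT =>
    PersuasionProblem.expectedRegret_le hv R D hR hφ hmax hT⟩
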